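/- **Definitions.** Euclidean spaces are finite-dimensional real inner product spaces. A *quasiNil-algebra of rank $n$* is an orthogonal sum $N=\bigoplus_{1\le i<j\le n}N_{ij}$ of Euclidean spaces with the matrix multiplication $(AB)_{ik}=\sum_j a_{ij}b_{jk}$ given by bilinear maps $N_{ij}\times N_{jk}\to N_{ik}$ ($i<j<k$) with $|xy|=|x||y|$. It is a *Nil-algebra* if it is associative and satisfies the *Vinberg condition*: for $i<j$, $a\in N_{ik}$, $b\in N_{jk}$, $\langle a,N b\rangle=0$ implies $\langle N a,N b\rangle=0$. Its *nilpotency index* is the maximal number of edges of a directed path in the graph on $\{1,\dots,n\}$ with an edge $i\to j$ whenever $N_{ij}\ne0$. *Isomorphisms* are algebra isomorphisms preserving the bigradation and the metric; *equivalence* is isomorphism after a renumbering of the indices. The *anti-transpose* $N^\tau$ has $N^\tau_{ij}=N_{n+1-j,\,n+1-i}$ with reversed products; "up to anti-transposition" means for $N$ or for $N^\tau$. A graded $\mathrm{Cl}(V)$-module $S^0\oplus S^1$ ($v^2=-|v|^2$, vectors are odd) carries a Euclidean metric with $S^0\perp S^1$ for which vectors act skew-adjointly. A bigraded $\mathrm{Cl}(V^{10})\otimes\mathrm{Cl}(V^{01})$-module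 $S^{00}\oplus S^{10}\oplus S^{01}\oplus S^{11}$ is a $\mathbb Z/2\times\mathbb Z/2$-graded module (generators from $V^{10}$ of degree $(1,0)$, from $V^{01}$ of degree $(0,1)$, commuting with each other) with an orthogonal sum metric for which the generators act skew-adjointly. A quasiNil-algebra is *Clifford* if each non-zero map $N_{ij}\times N_{jk}\to N_{ik}$ is the Clifford multiplication $V\times S^0\to S^1$ of a graded $\mathrm{Cl}(V)$-module, with $V=N_{ij}$, $S^0=N_{jk}$, or with $V=N_{jk}$, $S^0=N_{ij}$, and $S^1=N_{ik}$. **Theorem.** Let $N$ be a quasiNil-algebra of rank $4$ and nilpotency index $3$. (a) $N$ is associative and Clifford if and only if, up to anti-transposition, it is isomorphic to one of $$ N_{(0)}=\begin{pmatrix}0&V^{10}&S^{10}&S^{11}\\0&0&S^{00}&S^{01}\\0&0&0&V^{01}\\0&0&0&0\end{pmatrix},\quad N_{(1)}=\begin{pmatrix}0&\mathbb R&V&S^1\\0&0&V&S^1\\0&0&0&S^0\\0&0&0&0\end{pmatrix},\quad N_{(2)}=\begin{pmatrix}0&V&V&S^0\\0&0&\mathbb R&S^1\\0&0&0&S^1\\0&0&0&0\end{pmatrix},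 $$ $$ N_{(3)}=\begin{pmatrix}0&\mathbb C&\mathbb C&\mathbb C^n\\0&0&\mathbb C&\mathbb C^n\\0&0&0&\mathbb C^n\\0&0&0&0\end{pmatrix},\quad N_{(4)}=\begin{pmatrix}0&W&\mathbb H&\mathbb H^n\\0&0&\mathbb H&\mathbb H^n\\0&0&0&\mathbb H^n\\0&0&0&0\end{pmatrix},\quad N_{(5)}=\begin{pmatrix}0&\mathbb H&\mathbb H&\mathbb H^n\\0&0&W&\mathbb H^n\\0&0&0&\mathbb H^n\\0&0&0&0\end{pmatrix}, $$ where in $N_{(0)}$ the $S^{kl}$ form a bigraded $\mathrm{Cl}(V^{10})\otimes\mathrm{Cl}(V^{01})$-module, in $N_{(1)},N_{(2)}$ $S^0\oplus S^1$ is a graded $\mathrm{Cl}(V)$-module, $W\subset\mathbb H$ is a real vector subspace, and the products are the Clifford multiplications, multiplication by real scalars, and the multiplications of $\mathbb C$, $\mathbb H$ (acting on the left on $\mathbb C^n$, $\mathbb H^n$). (b) Suppose that $N$ is associative and Clifford. Then $N$ is not a Clifford Nil-algebra (that is, it fails the Vinberg condition) if and only if, up to anti-transposition, it is equivalent to $N_{(2)}$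 with $\dim V>1$ or to $N_{(5)}$ ($W$ in position $(2,3)$) with $\dim_{\mathbb R}W<4$. Hence $N$ is a Clifford Nil-algebra if and only if, up to anti-transposition, it is isomorphic to one of $N_{(0)},N_{(1)},N_{(3)},N_{(4)}$. -/

import Mathlib

open scoped Quaternion InnerProductSpace TensorProduct

universe u v

noncomputable section

/-- A Euclidean space: a finite-dimensional real inner product space (possibly zero). -/
structure EuclSp : Type (u + 1) where
  carrier : Type u
  [normed : NormedAddCommGroup carrier]
  [innerProd : InnerProductSpace ℝ carrier]
  [finDim : FiniteDimensional ℝ carrier]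

namespace EuclSp

instance : CoeSort EuclSp.{u} (Type u) := ⟨carrier⟩
instance (E : EuclSp.{u}) : NormedAddCommGroup E := E.normed
instance (E : EuclSp.{u}) : InnerProductSpace ℝ E := E.innerProd
instance (E : EuclSp.{u}) : FiniteDimensional ℝ E := E.finDim

/-- The zero space. -/
def zero : EuclSp.{0} := ⟨EuclideanSpace ℝ (Fin 0)⟩

end EuclSp

/-! ### QuasiNil-algebras -/

/-- A quasiNil-algebra of rank `n`: the Euclidean spaces `N_{ij}`, which vanish unless `i < j`, and
bilinear maps `N_{ij} × N_{jk} → N_{ik}` that are isometric, `‖x y‖ = ‖x‖ ‖y‖`, for `i < j < k`. -/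
structure QuasiNil (n : ℕ) : Type (u + 1) where
  comp : Fin n → Fin n → EuclSp.{u}
  comp_zero : ∀ i j, ¬ i < j → Subsingleton (comp i j)
  mul : ∀ i j k, comp i j →ₗ[ℝ] comp j k →ₗ[ℝ] comp i k
  isometric : ∀ i j k, i < j → j < k → ∀ (x : comp i j) (y : comp j k),
    ‖mul i j k x y‖ = ‖x‖ * ‖y‖

namespace QuasiNil

variable {n : ℕ}

/-- The underlying vector space of the algebra: strictly upper triangular matrices `(a_{ij})` with
`a_{ij} ∈ N_{ij}` (the entries with `¬ i < j` are automatically zero). -/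
abbrev Mat (N : QuasiNil.{u} n) : Type u := ∀ i j, N.comp i j

/-- Matrix multiplication `(A B)_{ik} = ∑ j, a_{ij} b_{jk}`. -/
def matMul (N : QuasiNil.{u} n) (A B : N.Mat) : N.Mat :=
  fun i k => ∑ j, N.mul i j k (A i j) (B j k)

/-- The Euclidean metric of the algebra; the components `N_{ij}` are pairwise orthogonal. -/
def matInner (N : QuasiNil.{u} n) (A B : N.Mat) : ℝ :=
  ∑ i, ∑ j, ⟪A i j, B i j⟫_ℝ

/-- An element of `N_{ij}` as an element of the algebra. -/
def single (N : QuasiNil.{u} n) (i j : Fin n) (a : N.comp i j) : N.Mat :=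
  Pi.single i (Pi.single j a)

/-- The algebra is associative. -/
def IsAssociative (N : QuasiNil.{u} n) : Prop :=
  ∀ A B C : N.Mat, N.matMul (N.matMul A B) C = N.matMul A (N.matMul B C)

/-- The Vinberg condition: for `i < j`, `a ∈ N_{ik}` and `b ∈ N_{jk}`, if `⟨a, N b⟩ = 0` then
`⟨N a, N b⟩ = 0`. -/
def VinbergCondition (N : QuasiNil.{u} n) : Prop :=
  ∀ (i j k : Fin n), i < j → ∀ (a : N.comp i k) (b : N.comp j k),
    (∀ X : N.Mat, N.matInner (N.single i k a) (N.matMul X (N.single j k b)) = 0) →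
    ∀ X Y : N.Mat,
      N.matInner (N.matMul X (N.single i k a)) (N.matMul Y (N.single j k b)) = 0

/-- A Nil-algebra: an associative quasiNil-algebra that satisfies the Vinberg condition. -/
def IsNil (N : QuasiNil.{u} n) : Prop :=
  N.IsAssociative ∧ N.VinbergCondition

/-- The edges of the adjacency graph: `N_{ij} ≠ 0`. -/
def Adj (N : QuasiNil.{u} n) (i j : Fin n) : Prop := Nontrivial (N.comp i j)

/-- The nilpotency index: the maximal length (number of edges) of a directed path in the adjacency
graph. -/
def nilpotencyIndex (N : QuasiNil.{u} n) : ℕ :=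
  sSup {m | ∃ p : Fin (m + 1) → Fin n, ∀ t : Fin m, N.Adj (p t.castSucc) (p t.succ)}

/-- Isomorphism: an isomorphism of algebras preserving the bigradation and the metric. -/
def Isomorphic (N : QuasiNil.{u} n) (N' : QuasiNil.{v} n) : Prop :=
  ∃ φ : ∀ i j, N.comp i j ≃ₗᵢ[ℝ] N'.comp i j,
    ∀ i j k (x : N.comp i j) (y : N.comp j k),
      φ i k (N.mul i j k x y) = N'.mul i j k (φ i j x) (φ j k y)

/-- Equivalence: isomorphism after a renumbering of the indices by a permutation `σ`. Since
`N'_{pq} = 0` unless `p < q`, only admissible renumberings of `N` can occur. -/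
def Equivalent (N : QuasiNil.{u} n) (N' : QuasiNil.{v} n) : Prop :=
  ∃ (σ : Equiv.Perm (Fin n)) (φ : ∀ i j, N.comp i j ≃ₗᵢ[ℝ] N'.comp (σ i) (σ j)),
    ∀ i j k (x : N.comp i j) (y : N.comp j k),
      φ i k (N.mul i j k x y) = N'.mul (σ i) (σ j) (σ k) (φ i j x) (φ j k y)

/-- The dual algebra, obtained by anti-transposition (reflection in the anti-diagonal):
`N^τ_{ij} = N_{n+1-j, n+1-i}`, with the factors of each product exchanged. -/
def dual (N : QuasiNil.{u} n) : QuasiNil.{u} n where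
  comp i j := N.comp j.rev i.rev
  comp_zero i j h := N.comp_zero _ _ (by simpa using h)
  mul i j k := (N.mul k.rev j.rev i.rev).flip
  isometric i j k hij hjk x y := by
    rw [LinearMap.flip_apply, N.isometric _ _ _ (by simpa using hjk) (by simpa using hij), mul_comm]

end QuasiNil

/-! ### Clifford modules -/

/-- The quadratic form `v ↦ -‖v‖²` of a Euclidean space. -/
def negSq (V : EuclSp.{u}) : QuadraticForm ℝ V :=
  -LinearMap.BilinMap.toQuadraticMap (innerₗ V)

theorem negSq_apply (V : EuclSp.{u}) (x : V) : negSq V x = -(‖x‖ * ‖x‖) := by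
  change -(⟪x, x⟫_ℝ) = _
  rw [real_inner_self_eq_norm_mul_norm]

/-- The Clifford algebra `Cl(V)`, with relations `v² = -‖v‖²`. -/
abbrev Cl (V : EuclSp.{u}) : Type u := CliffordAlgebra (negSq V)

/-- A `ℤ/2`-graded `Cl(V)`-module structure on `S⁰ ⊕ S¹` for which the Euclidean metric of the
orthogonal sum is admissible, i.e. vectors `v ∈ V` act by skew-adjoint operators
(equivalently: unit vectors act by isometries). -/
structure GradedCliffordModule (V S0 S1 : EuclSp.{u}) where
  act : Cl V →ₐ[ℝ] Module.End ℝ (S0 × S1)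
  odd_zero : ∀ (v : V) (s : S0), ∃ t : S1, act (CliffordAlgebra.ι (negSq V) v) (s, 0) = (0, t)
  odd_one : ∀ (v : V) (t : S1), ∃ s : S0, act (CliffordAlgebra.ι (negSq V) v) (0, t) = (s, 0)
  skew : ∀ (v : V) (s : S0) (t : S1),
    ⟪(act (CliffordAlgebra.ι (negSq V) v) (s, 0)).2, t⟫_ℝ =
      -⟪s, (act (CliffordAlgebra.ι (negSq V) v) (0, t)).1⟫_ℝ

/-- The bilinear map `V × X → Y` given by the action of generators on a module `T`, followed by a
projection of `T` onto `Y`, and preceded by an inclusion of `X` in `T`. -/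
def actionMap {V X Y A T : Type*} [AddCommGroup V] [AddCommGroup X] [AddCommGroup Y]
    [AddCommGroup T] [Module ℝ V] [Module ℝ X] [Module ℝ Y] [Module ℝ T] [Ring A] [Algebra ℝ A]
    (act : A →ₐ[ℝ] Module.End ℝ T) (gen : V →ₗ[ℝ] A) (incl : X →ₗ[ℝ] T) (proj : T →ₗ[ℝ] Y) :
    V →ₗ[ℝ] X →ₗ[ℝ] Y :=
  LinearMap.mk₂ ℝ (fun w x => proj (act (gen w) (incl x)))
    (by intros; simp) (by intros; simp) (by intros; simp) (by intros; simp)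

/-- A skew operator with square `-r²` is `r` times an isometry. -/
theorem norm_eq_of_skew {X Y : EuclSp.{u}} {r : ℝ} (hr : 0 ≤ r) {s : X} {t : Y} {s' : X}
    (h : ⟪t, t⟫_ℝ = -⟪s, s'⟫_ℝ) (h' : s' = (-(r * r)) • s) : ‖t‖ = r * ‖s‖ := by
  subst h'
  rw [inner_smul_right, real_inner_self_eq_norm_mul_norm, real_inner_self_eq_norm_mul_norm] at h
  have h2 : ‖t‖ ^ 2 = (r * ‖s‖) ^ 2 := by nlinarith
  exact (sq_eq_sq₀ (norm_nonneg _) (mul_nonneg hr (norm_nonneg _))).1 h2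

namespace GradedCliffordModule

variable {V S0 S1 : EuclSp.{u}} (M : GradedCliffordModule V S0 S1)

/-- Clifford multiplication `V × S⁰ → S¹`. -/
def mulZero : V →ₗ[ℝ] S0 →ₗ[ℝ] S1 :=
  actionMap M.act (CliffordAlgebra.ι (negSq V)) (LinearMap.inl ℝ S0 S1) (LinearMap.snd ℝ S0 S1)

/-- Clifford multiplication `V × S¹ → S⁰`. -/
def mulOne : V →ₗ[ℝ] S1 →ₗ[ℝ] S0 :=
  actionMap M.act (CliffordAlgebra.ι (negSq V)) (LinearMap.inr ℝ S0 S1) (LinearMap.fst ℝ S0 S1)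

theorem act_sq (w : V) (x : S0 × S1) :
    M.act (CliffordAlgebra.ι (negSq V) w) (M.act (CliffordAlgebra.ι (negSq V) w) x) =
      (-(‖w‖ * ‖w‖)) • x := by
  rw [← Module.End.mul_apply, ← map_mul, CliffordAlgebra.ι_sq_scalar, AlgHom.commutes, negSq_apply]
  rfl

theorem norm_mulZero (w : V) (s : S0) : ‖M.mulZero w s‖ = ‖w‖ * ‖s‖ := by
  obtain ⟨t, ht⟩ := M.odd_zero w s
  have h1 : M.mulZero w s = t := congrArg Prod.snd ht
  have h2 := M.act_sq w (s, 0)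
  rw [ht] at h2
  have h3 := M.skew w s t
  rw [ht, h2] at h3
  rw [h1]
  exact norm_eq_of_skew (norm_nonneg w) h3 rfl

theorem norm_mulOne (w : V) (t : S1) : ‖M.mulOne w t‖ = ‖w‖ * ‖t‖ := by
  obtain ⟨s, hs⟩ := M.odd_one w t
  have h1 : M.mulOne w t = s := congrArg Prod.fst hs
  have h2 := M.act_sq w (0, t)
  rw [hs] at h2
  have h3 := M.skew w s t
  rw [hs, h2] at h3
  rw [h1]
  refine norm_eq_of_skew (norm_nonneg w) (s := t) (s' := (-(‖w‖ * ‖w‖)) • t) ?_ rfl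
  have h4 : ⟪(-(‖w‖ * ‖w‖)) • t, t⟫_ℝ = -⟪s, s⟫_ℝ := h3
  rw [real_inner_comm] at h4
  linarith

end GradedCliffordModule

namespace QuasiNil

variable {n : ℕ}

/-- A quasiNil-algebra is Clifford if each non-zero map `N_{ij} × N_{jk} → N_{ik}` is the Clifford
multiplication `V × S⁰ → S¹` of a graded `Cl(V)`-module `S⁰ ⊕ S¹`, where either `V = N_{ij}`,
`S⁰ = N_{jk}`, `S¹ = N_{ik}`, or `V = N_{jk}`, `S⁰ = N_{ij}`, `S¹ = N_{ik}`. -/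
def IsClifford (N : QuasiNil.{u} n) : Prop :=
  ∀ i j k, N.mul i j k ≠ 0 →
    (∃ M : GradedCliffordModule (N.comp i j) (N.comp j k) (N.comp i k),
      ∀ x y, N.mul i j k x y = M.mulZero x y) ∨
    (∃ M : GradedCliffordModule (N.comp j k) (N.comp i j) (N.comp i k),
      ∀ x y, N.mul i j k x y = M.mulZero y x)

end QuasiNil

/-- The inner product of the orthogonal sum `S⁰⁰ ⊕ S¹⁰ ⊕ S⁰¹ ⊕ S¹¹`. -/
def sumInner {S00 S10 S01 S11 : EuclSp.{u}} (x y : (S00 × S10) × (S01 × S11)) : ℝ :=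
  ⟪x.1.1, y.1.1⟫_ℝ + ⟪x.1.2, y.1.2⟫_ℝ + ⟪x.2.1, y.2.1⟫_ℝ + ⟪x.2.2, y.2.2⟫_ℝ

/-- A `ℤ/2 × ℤ/2`-bigraded `Cl(V¹⁰) ⊗ Cl(V⁰¹)`-module structure on
`S = S⁰⁰ ⊕ S¹⁰ ⊕ S⁰¹ ⊕ S¹¹` (ungraded tensor product of algebras) for which the Euclidean metric of
the orthogonal sum is admissible. The generators from `V¹⁰` have bidegree `(1,0)`, those from `V⁰¹`
bidegree `(0,1)`, and both act by skew-adjoint operators. An element of `S` is written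
`((s⁰⁰, s¹⁰), (s⁰¹, s¹¹))`. -/
structure BigradedCliffordModule (V10 V01 S00 S10 S01 S11 : EuclSp.{u}) where
  act : (Cl V10 ⊗[ℝ] Cl V01) →ₐ[ℝ] Module.End ℝ ((S00 × S10) × (S01 × S11))
  left00 : ∀ (w : V10) (s : S00), ∃ t : S10,
    act (CliffordAlgebra.ι (negSq V10) w ⊗ₜ 1) ((s, 0), (0, 0)) = ((0, t), (0, 0))
  left10 : ∀ (w : V10) (s : S10), ∃ t : S00,
    act (CliffordAlgebra.ι (negSq V10) w ⊗ₜ 1) ((0, s), (0, 0)) = ((t, 0), (0, 0))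
  left01 : ∀ (w : V10) (s : S01), ∃ t : S11,
    act (CliffordAlgebra.ι (negSq V10) w ⊗ₜ 1) ((0, 0), (s, 0)) = ((0, 0), (0, t))
  left11 : ∀ (w : V10) (s : S11), ∃ t : S01,
    act (CliffordAlgebra.ι (negSq V10) w ⊗ₜ 1) ((0, 0), (0, s)) = ((0, 0), (t, 0))
  right00 : ∀ (w : V01) (s : S00), ∃ t : S01,
    act (1 ⊗ₜ CliffordAlgebra.ι (negSq V01) w) ((s, 0), (0, 0)) = ((0, 0), (t, 0))
  right01 : ∀ (w : V01) (s : S01), ∃ t : S00,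
    act (1 ⊗ₜ CliffordAlgebra.ι (negSq V01) w) ((0, 0), (s, 0)) = ((t, 0), (0, 0))
  right10 : ∀ (w : V01) (s : S10), ∃ t : S11,
    act (1 ⊗ₜ CliffordAlgebra.ι (negSq V01) w) ((0, s), (0, 0)) = ((0, 0), (0, t))
  right11 : ∀ (w : V01) (s : S11), ∃ t : S10,
    act (1 ⊗ₜ CliffordAlgebra.ι (negSq V01) w) ((0, 0), (0, s)) = ((0, t), (0, 0))
  skew_left : ∀ (w : V10) (x y : (S00 × S10) × (S01 × S11)),
    sumInner (act (CliffordAlgebra.ι (negSq V10) w ⊗ₜ 1) x) y =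
      -sumInner x (act (CliffordAlgebra.ι (negSq V10) w ⊗ₜ 1) y)
  skew_right : ∀ (w : V01) (x y : (S00 × S10) × (S01 × S11)),
    sumInner (act (1 ⊗ₜ CliffordAlgebra.ι (negSq V01) w) x) y =
      -sumInner x (act (1 ⊗ₜ CliffordAlgebra.ι (negSq V01) w) y)

namespace BigradedCliffordModule

variable {V10 V01 S00 S10 S01 S11 : EuclSp.{u}}
  (M : BigradedCliffordModule V10 V01 S00 S10 S01 S11)

/-- The generators `w ⊗ 1`, `w ∈ V¹⁰`. -/
def genLeft (V10 V01 : EuclSp.{u}) : V10 →ₗ[ℝ] Cl V10 ⊗[ℝ] Cl V01 :=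
  (Algebra.TensorProduct.includeLeft (R := ℝ) (S := ℝ) (A := Cl V10) (B := Cl V01)).toLinearMap ∘ₗ
    CliffordAlgebra.ι (negSq V10)

/-- The generators `1 ⊗ w`, `w ∈ V⁰¹`. -/
def genRight (V10 V01 : EuclSp.{u}) : V01 →ₗ[ℝ] Cl V10 ⊗[ℝ] Cl V01 :=
  (Algebra.TensorProduct.includeRight (R := ℝ) (A := Cl V10) (B := Cl V01)).toLinearMap ∘ₗ
    CliffordAlgebra.ι (negSq V01)

/-- `V¹⁰ × S⁰⁰ → S¹⁰`. -/
def mulLeft0 : V10 →ₗ[ℝ] S00 →ₗ[ℝ] S10 :=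
  actionMap M.act (genLeft V10 V01)
    (LinearMap.inl ℝ (S00 × S10) (S01 × S11) ∘ₗ LinearMap.inl ℝ S00 S10)
    (LinearMap.snd ℝ S00 S10 ∘ₗ LinearMap.fst ℝ (S00 × S10) (S01 × S11))

/-- `V¹⁰ × S⁰¹ → S¹¹`. -/
def mulLeft1 : V10 →ₗ[ℝ] S01 →ₗ[ℝ] S11 :=
  actionMap M.act (genLeft V10 V01)
    (LinearMap.inr ℝ (S00 × S10) (S01 × S11) ∘ₗ LinearMap.inl ℝ S01 S11)
    (LinearMap.snd ℝ S01 S11 ∘ₗ LinearMap.snd ℝ (S00 × S10) (S01 × S11))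

/-- `V⁰¹ × S⁰⁰ → S⁰¹`. -/
def mulRight0 : V01 →ₗ[ℝ] S00 →ₗ[ℝ] S01 :=
  actionMap M.act (genRight V10 V01)
    (LinearMap.inl ℝ (S00 × S10) (S01 × S11) ∘ₗ LinearMap.inl ℝ S00 S10)
    (LinearMap.fst ℝ S01 S11 ∘ₗ LinearMap.snd ℝ (S00 × S10) (S01 × S11))

/-- `V⁰¹ × S¹⁰ → S¹¹`. -/
def mulRight1 : V01 →ₗ[ℝ] S10 →ₗ[ℝ] S11 :=
  actionMap M.act (genRight V10 V01)
    (LinearMap.inl ℝ (S00 × S10) (S01 × S11) ∘ₗ LinearMap.inr ℝ S00 S10)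
    (LinearMap.snd ℝ S01 S11 ∘ₗ LinearMap.snd ℝ (S00 × S10) (S01 × S11))

theorem left_sq (w : V10) (x : (S00 × S10) × (S01 × S11)) :
    M.act (CliffordAlgebra.ι (negSq V10) w ⊗ₜ 1) (M.act (CliffordAlgebra.ι (negSq V10) w ⊗ₜ 1) x) =
      (-(‖w‖ * ‖w‖)) • x := by
  rw [← Module.End.mul_apply, ← map_mul, Algebra.TensorProduct.tmul_mul_tmul,
    CliffordAlgebra.ι_sq_scalar, negSq_apply, mul_one, Algebra.algebraMap_eq_smul_one,
    ← TensorProduct.smul_tmul', ← Algebra.TensorProduct.one_def, map_smul, map_one]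
  rfl

theorem right_sq (w : V01) (x : (S00 × S10) × (S01 × S11)) :
    M.act (1 ⊗ₜ CliffordAlgebra.ι (negSq V01) w) (M.act (1 ⊗ₜ CliffordAlgebra.ι (negSq V01) w) x) =
      (-(‖w‖ * ‖w‖)) • x := by
  rw [← Module.End.mul_apply, ← map_mul, Algebra.TensorProduct.tmul_mul_tmul,
    CliffordAlgebra.ι_sq_scalar, negSq_apply, mul_one, Algebra.algebraMap_eq_smul_one,
    TensorProduct.tmul_smul, ← Algebra.TensorProduct.one_def, map_smul, map_one]
  rfl

theorem norm_mulLeft0 (w : V10) (s : S00) : ‖M.mulLeft0 w s‖ = ‖w‖ * ‖s‖ := by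
  obtain ⟨t, ht⟩ := M.left00 w s
  have h1 : M.mulLeft0 w s = t := congrArg (fun x => x.1.2) ht
  have h3 := M.skew_left w ((s, 0), (0, 0)) ((0, t), (0, 0))
  rw [← ht, M.left_sq, ht] at h3
  rw [h1]
  exact norm_eq_of_skew (norm_nonneg w) (by simpa [sumInner] using h3) rfl

theorem norm_mulLeft1 (w : V10) (s : S01) : ‖M.mulLeft1 w s‖ = ‖w‖ * ‖s‖ := by
  obtain ⟨t, ht⟩ := M.left01 w s
  have h1 : M.mulLeft1 w s = t := congrArg (fun x => x.2.2) ht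
  have h3 := M.skew_left w ((0, 0), (s, 0)) ((0, 0), (0, t))
  rw [← ht, M.left_sq, ht] at h3
  rw [h1]
  exact norm_eq_of_skew (norm_nonneg w) (by simpa [sumInner] using h3) rfl

theorem norm_mulRight0 (w : V01) (s : S00) : ‖M.mulRight0 w s‖ = ‖w‖ * ‖s‖ := by
  obtain ⟨t, ht⟩ := M.right00 w s
  have h1 : M.mulRight0 w s = t := congrArg (fun x => x.2.1) ht
  have h3 := M.skew_right w ((s, 0), (0, 0)) ((0, 0), (t, 0))
  rw [← ht, M.right_sq, ht] at h3
  rw [h1]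
  exact norm_eq_of_skew (norm_nonneg w) (by simpa [sumInner] using h3) rfl

theorem norm_mulRight1 (w : V01) (s : S10) : ‖M.mulRight1 w s‖ = ‖w‖ * ‖s‖ := by
  obtain ⟨t, ht⟩ := M.right10 w s
  have h1 : M.mulRight1 w s = t := congrArg (fun x => x.2.2) ht
  have h3 := M.skew_right w ((0, s), (0, 0)) ((0, 0), (0, t))
  rw [← ht, M.right_sq, ht] at h3
  rw [h1]
  exact norm_eq_of_skew (norm_nonneg w) (by simpa [sumInner] using h3) rfl

end BigradedCliffordModule

/-! ### The rank 4 algebras of the classification -/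

namespace QuasiNil

/-- The entries of a strictly upper triangular `4 × 4` block matrix (indices start at `0`). -/
def blockComp (X12 X13 X14 X23 X24 X34 : EuclSp.{0}) : Fin 4 → Fin 4 → EuclSp.{0}
  | 0, 1 => X12
  | 0, 2 => X13
  | 0, 3 => X14
  | 1, 2 => X23
  | 1, 3 => X24
  | 2, 3 => X34
  | _, _ => EuclSp.zero

/-- The products of a strictly upper triangular `4 × 4` block matrix algebra. -/
def blockMul {X12 X13 X14 X23 X24 X34 : EuclSp.{0}}
    (m123 : X12 →ₗ[ℝ] X23 →ₗ[ℝ] X13) (m124 : X12 →ₗ[ℝ] X24 →ₗ[ℝ] X14)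
    (m134 : X13 →ₗ[ℝ] X34 →ₗ[ℝ] X14) (m234 : X23 →ₗ[ℝ] X34 →ₗ[ℝ] X24) :
    ∀ i j k : Fin 4, blockComp X12 X13 X14 X23 X24 X34 i j →ₗ[ℝ]
      blockComp X12 X13 X14 X23 X24 X34 j k →ₗ[ℝ] blockComp X12 X13 X14 X23 X24 X34 i k
  | 0, 1, 2 => m123
  | 0, 1, 3 => m124
  | 0, 2, 3 => m134
  | 1, 2, 3 => m234
  | _, _, _ => 0

/-- The rank 4 quasiNil-algebra of block matrices
```
0 X12 X13 X14
0  0  X23 X24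
0  0   0  X34
0  0   0   0
```
with the given isometric products. -/
def ofBlocks {X12 X13 X14 X23 X24 X34 : EuclSp.{0}}
    (m123 : X12 →ₗ[ℝ] X23 →ₗ[ℝ] X13) (m124 : X12 →ₗ[ℝ] X24 →ₗ[ℝ] X14)
    (m134 : X13 →ₗ[ℝ] X34 →ₗ[ℝ] X14) (m234 : X23 →ₗ[ℝ] X34 →ₗ[ℝ] X24)
    (h123 : ∀ x y, ‖m123 x y‖ = ‖x‖ * ‖y‖) (h124 : ∀ x y, ‖m124 x y‖ = ‖x‖ * ‖y‖)
    (h134 : ∀ x y, ‖m134 x y‖ = ‖x‖ * ‖y‖) (h234 : ∀ x y, ‖m234 x y‖ = ‖x‖ * ‖y‖) :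
    QuasiNil.{0} 4 where
  comp := blockComp X12 X13 X14 X23 X24 X34
  comp_zero := by
    have h : Subsingleton EuclSp.zero := inferInstanceAs (Subsingleton (EuclideanSpace ℝ (Fin 0)))
    intro i j hij
    fin_cases i <;> fin_cases j <;> first | exact h | exact absurd (by decide) hij
  mul := blockMul m123 m124 m134 m234
  isometric := by
    intro i j k hij hjk
    fin_cases i <;> fin_cases j <;> first | exact absurd hij (by decide) | skip
    all_goals fin_cases k <;> first
      | exact absurd hjk (by decide) | exact h123 | exact h124 | exact h134 | exact h234

/-- The Euclidean line `ℝ`. -/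
def lineSp : EuclSp.{0} := ⟨ℝ⟩
/-- The Euclidean plane `ℂ`. -/
def complexSp : EuclSp.{0} := ⟨ℂ⟩
/-- The Euclidean space `ℂ^n`. -/
def complexPowSp (n : ℕ) : EuclSp.{0} := ⟨PiLp 2 fun _ : Fin n => ℂ⟩
/-- The Euclidean space `ℍ`. -/
def quatSp : EuclSp.{0} := ⟨ℍ[ℝ]⟩
/-- The Euclidean space `ℍ^n`. -/
def quatPowSp (n : ℕ) : EuclSp.{0} := ⟨PiLp 2 fun _ : Fin n => ℍ[ℝ]⟩
/-- A real subspace `W ⊆ ℍ` with the induced metric. -/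
def subSp (W : Submodule ℝ ℍ[ℝ]) : EuclSp.{0} := ⟨W⟩

/-- Scalar multiplication `ℝ × E → E`. -/
def scalarMul (E : EuclSp.{0}) : lineSp →ₗ[ℝ] E →ₗ[ℝ] E := LinearMap.lsmul ℝ E

theorem norm_scalarMul (E : EuclSp.{0}) (r : lineSp) (x : E) :
    ‖scalarMul E r x‖ = ‖r‖ * ‖x‖ := norm_smul (α := ℝ) r x

section Alg

variable {A : Type} [NormedRing A] [NormMulClass A] [NormedSpace ℝ A] [IsScalarTower ℝ A A]
  [SMulCommClass ℝ A A]

/-- Left multiplication `A × A^n → A^n`, `a (x_1, …, x_n) = (a x_1, …, a x_n)`. -/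
def powMul (A : Type) [NormedRing A] [NormMulClass A] [NormedSpace ℝ A]
    [IsScalarTower ℝ A A] [SMulCommClass ℝ A A] (n : ℕ) :
    A →ₗ[ℝ] (PiLp 2 fun _ : Fin n => A) →ₗ[ℝ] (PiLp 2 fun _ : Fin n => A) :=
  LinearMap.mk₂ ℝ (fun a x => WithLp.toLp 2 fun t => a * x t)
    (by intros; ext; simp [add_mul]) (by intros; ext; simp [smul_mul_assoc])
    (by intros; ext; simp [mul_add]) (by intros; ext; simp [mul_smul_comm])

theorem norm_powMul (n : ℕ) (a : A) (x : PiLp 2 fun _ : Fin n => A) :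
    ‖powMul A n a x‖ = ‖a‖ * ‖x‖ := by
  have h : powMul A n a x = WithLp.toLp 2 fun t => a * x t := rfl
  rw [h, PiLp.norm_eq_of_L2, PiLp.norm_eq_of_L2]
  simp only [_root_.norm_mul, mul_pow, ← Finset.mul_sum]
  rw [Real.sqrt_mul (by positivity), Real.sqrt_sq (norm_nonneg a)]

end Alg

/-- The multiplication `ℂ × ℂ → ℂ`. -/
def cMul : complexSp →ₗ[ℝ] complexSp →ₗ[ℝ] complexSp := LinearMap.mul ℝ ℂ
/-- `ℂ × ℂ^n → ℂ^n`. -/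
def cPow (n : ℕ) : complexSp →ₗ[ℝ] complexPowSp n →ₗ[ℝ] complexPowSp n := powMul ℂ n
/-- `ℍ × ℍ^n → ℍ^n`. -/
def hPow (n : ℕ) : quatSp →ₗ[ℝ] quatPowSp n →ₗ[ℝ] quatPowSp n := powMul ℍ[ℝ] n
/-- The restriction `W × ℍ → ℍ` of quaternion multiplication. -/
def wMul (W : Submodule ℝ ℍ[ℝ]) : subSp W →ₗ[ℝ] quatSp →ₗ[ℝ] quatSp :=
  LinearMap.mul ℝ ℍ[ℝ] ∘ₗ W.subtype
/-- The restriction `ℍ × W → ℍ` of quaternion multiplication. -/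
def mulW (W : Submodule ℝ ℍ[ℝ]) : quatSp →ₗ[ℝ] subSp W →ₗ[ℝ] quatSp :=
  (LinearMap.mul ℝ ℍ[ℝ]).compl₂ W.subtype
/-- The restriction `W × ℍ^n → ℍ^n` of scalar multiplication. -/
def wPow (W : Submodule ℝ ℍ[ℝ]) (n : ℕ) : subSp W →ₗ[ℝ] quatPowSp n →ₗ[ℝ] quatPowSp n :=
  powMul ℍ[ℝ] n ∘ₗ W.subtype

/-- The algebra of a bigraded `Cl(V¹⁰) ⊗ Cl(V⁰¹)`-module, with the Clifford products:
```
0  V10  S10  S11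
0   0   S00  S01
0   0    0   V01
0   0    0    0
```
-/
def algN0 {V10 V01 S00 S10 S01 S11 : EuclSp.{0}}
    (M : BigradedCliffordModule V10 V01 S00 S10 S01 S11) : QuasiNil.{0} 4 :=
  ofBlocks (X12 := V10) (X13 := S10) (X14 := S11) (X23 := S00) (X24 := S01) (X34 := V01)
    M.mulLeft0 M.mulLeft1 M.mulRight1.flip M.mulRight0.flip
    M.norm_mulLeft0 M.norm_mulLeft1
    (fun x y => (M.norm_mulRight1 y x).trans (mul_comm _ _))
    (fun x y => (M.norm_mulRight0 y x).trans (mul_comm _ _))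

/-- The algebra of a graded `Cl(V)`-module `S⁰ ⊕ S¹` with corner `ℝ` in position `(1,2)`:
```
0   ℝ   V   S1
0   0   V   S1
0   0   0   S0
0   0   0   0
```
-/
def algN1 {V S0 S1 : EuclSp.{0}} (M : GradedCliffordModule V S0 S1) : QuasiNil.{0} 4 :=
  ofBlocks (X12 := lineSp) (X13 := V) (X14 := S1) (X23 := V) (X24 := S1) (X34 := S0)
    (scalarMul V) (scalarMul S1) M.mulZero M.mulZero
    (norm_scalarMul V) (norm_scalarMul S1) M.norm_mulZero M.norm_mulZero

/-- The algebra of a graded `Cl(V)`-module `S⁰ ⊕ S¹` with `ℝ` in position `(2,3)`: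
```
0   V   V   S0
0   0   ℝ   S1
0   0   0   S1
0   0   0   0
```
-/
def algN2 {V S0 S1 : EuclSp.{0}} (M : GradedCliffordModule V S0 S1) : QuasiNil.{0} 4 :=
  ofBlocks (X12 := V) (X13 := V) (X14 := S0) (X23 := lineSp) (X24 := S1) (X34 := S1)
    (scalarMul V).flip M.mulOne M.mulOne (scalarMul S1)
    (fun x y => (norm_scalarMul V y x).trans (mul_comm _ _)) M.norm_mulOne M.norm_mulOne
    (norm_scalarMul S1)

/-- The complex family:
```
0   ℂ   ℂ   ℂ^n
0   0   ℂ   ℂ^n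
0   0   0   ℂ^n
0   0   0   0
```
-/
def algN3 (n : ℕ) : QuasiNil.{0} 4 :=
  ofBlocks (X12 := complexSp) (X13 := complexSp) (X14 := complexPowSp n) (X23 := complexSp)
    (X24 := complexPowSp n) (X34 := complexPowSp n)
    cMul (cPow n) (cPow n) (cPow n)
    (fun x y => norm_mul (α := ℂ) x y) (norm_powMul (A := ℂ) n) (norm_powMul (A := ℂ) n)
    (norm_powMul (A := ℂ) n)

/-- The quaternionic family with `W ⊆ ℍ` in position `(1,2)`:
```
0   W   ℍ   ℍ^n
0   0   ℍ   ℍ^n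
0   0   0   ℍ^n
0   0   0   0
```
-/
def algN4 (W : Submodule ℝ ℍ[ℝ]) (n : ℕ) : QuasiNil.{0} 4 :=
  ofBlocks (X12 := subSp W) (X13 := quatSp) (X14 := quatPowSp n) (X23 := quatSp)
    (X24 := quatPowSp n) (X34 := quatPowSp n)
    (wMul W) (wPow W n) (hPow n) (hPow n)
    (fun x y => norm_mul (α := ℍ[ℝ]) (W.subtype x) y)
    (fun x y => norm_powMul (A := ℍ[ℝ]) n (W.subtype x) y)
    (norm_powMul (A := ℍ[ℝ]) n) (norm_powMul (A := ℍ[ℝ]) n)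

/-- The quaternionic family with `W ⊆ ℍ` in position `(2,3)`:
```
0   ℍ   ℍ   ℍ^n
0   0   W   ℍ^n
0   0   0   ℍ^n
0   0   0   0
```
-/
def algN5 (W : Submodule ℝ ℍ[ℝ]) (n : ℕ) : QuasiNil.{0} 4 :=
  ofBlocks (X12 := quatSp) (X13 := quatSp) (X14 := quatPowSp n) (X23 := subSp W)
    (X24 := quatPowSp n) (X34 := quatPowSp n)
    (mulW W) (hPow n) (hPow n) (wPow W n)
    (fun x y => norm_mul (α := ℍ[ℝ]) x (W.subtype y))
    (norm_powMul (A := ℍ[ℝ]) n) (norm_powMul (A := ℍ[ℝ]) n)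
    (fun x y => norm_powMul (A := ℍ[ℝ]) n (W.subtype x) y)

/-- `N` is isomorphic to one of the algebras of a bigraded module. -/
def HasForm0 (N : QuasiNil.{u} 4) : Prop :=
  ∃ (V10 V01 S00 S10 S01 S11 : EuclSp.{0}) (M : BigradedCliffordModule V10 V01 S00 S10 S01 S11),
    N.Isomorphic (algN0 M)

/-- `N` is isomorphic to an algebra of a graded module with `ℝ` in position `(1,2)`. -/
def HasForm1 (N : QuasiNil.{u} 4) : Prop :=
  ∃ (V S0 S1 : EuclSp.{0}) (M : GradedCliffordModule V S0 S1), N.Isomorphic (algN1 M)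

/-- `N` is isomorphic to an algebra of a graded module with `ℝ` in position `(2,3)`. -/
def HasForm2 (N : QuasiNil.{u} 4) : Prop :=
  ∃ (V S0 S1 : EuclSp.{0}) (M : GradedCliffordModule V S0 S1), N.Isomorphic (algN2 M)

/-- `N` is isomorphic to a member of the complex family. -/
def HasForm3 (N : QuasiNil.{u} 4) : Prop :=
  ∃ n : ℕ, N.Isomorphic (algN3 n)

/-- `N` is isomorphic to a member of the quaternionic family with `W` in position `(1,2)`. -/
def HasForm4 (N : QuasiNil.{u} 4) : Prop :=
  ∃ (W : Submodule ℝ ℍ[ℝ]) (n : ℕ), N.Isomorphic (algN4 W n)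

/-- `N` is isomorphic to a member of the quaternionic family with `W` in position `(2,3)`. -/
def HasForm5 (N : QuasiNil.{u} 4) : Prop :=
  ∃ (W : Submodule ℝ ℍ[ℝ]) (n : ℕ), N.Isomorphic (algN5 W n)

/-- `N` has one of the six forms of the classification of associative Clifford quasiNil-algebras. -/
def HasAssociativeForm (N : QuasiNil.{u} 4) : Prop :=
  N.HasForm0 ∨ N.HasForm1 ∨ N.HasForm2 ∨ N.HasForm3 ∨ N.HasForm4 ∨ N.HasForm5

/-- `N` has one of the four forms of the classification of Clifford Nil-algebras. -/
def HasNilForm (N : QuasiNil.{u} 4) : Prop :=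
  N.HasForm0 ∨ N.HasForm1 ∨ N.HasForm3 ∨ N.HasForm4

/-- `N` is equivalent to an `algN2` with `dim V > 1`, or to an `algN5` with `dim W < 4`. -/
def IsExceptional (N : QuasiNil.{u} 4) : Prop :=
  (∃ (V S0 S1 : EuclSp.{0}) (M : GradedCliffordModule V S0 S1),
    1 < Module.finrank ℝ V ∧ N.Equivalent (algN2 M)) ∨
  (∃ (W : Submodule ℝ ℍ[ℝ]) (n : ℕ), Module.finrank ℝ W < 4 ∧ N.Equivalent (algN5 W n))

end QuasiNil

end

universe w

/-! ### Isometric bilinear maps -/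

noncomputable section

/-! Write $d_{ij}=\dim N_{ij}$ with indices starting at 0. A path of length 3 in rank 4 must be
$0\to1\to2\to3$, and isometric products have no zero divisors, so nilpotency index 3 means that all
six components above the diagonal are non-zero. All conditions except associativity then become
conditions on dimensions.

An isometric map $m:V\times X\to Y$ with $V\ne0$ is a Clifford multiplication exactly when $\dim
X=\dim Y$: each $m(v,\cdot)$ with $v\ne0$ is then an invertible similarity, and its negative adjoint
supplies the action on the other half of the module. So $N$ is Clifford iff each of its four
products has a factor of the same dimension as the product space (`IsFull.isClifford_iff`). For
associative Clifford $N$ the Vinberg condition amounts to $d_{12}=d_{02}$ or $d_{12}=d_{13}$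
(`IsAssociative.vinbergCondition_of_dim_eq`, `IsFull.dim_eq_of_vinbergCondition`);
anti-transposition exchanges the two alternatives.

The classification is a case analysis on dimensions. If $d_{12}=d_{02}=d_{13}=d_{03}$, associativity
says that left and right multiplications commute, which is a bigraded module, $N_{(0)}$. Otherwise,
up to anti-transposition, $d_{13}=d_{23}=d_{03}$, and either $d_{12}=d_{02}$ or $d_{01}=d_{02}$. If
$N_{01}$, respectively $N_{12}$, is a line, a unit vector of it identifies components in pairs and
leaves a single Clifford multiplication: $N_{(1)}$, $N_{(2)}$.

In the remaining cases unit vectors $a\in N_{01}$, $b\in N_{12}$ identify the last column with one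
space $S$, and $N_{02}$ becomes a space of similarities of $S$ containing $1$ and, thanks to
associativity, stable under multiplication on one side by some $u\perp1$. Such a space is $\mathbb
C$ or $\mathbb H$ (`complex_or_quaternion_action`): if $j\perp1,u$ then $1,u,j,uj$ span $\mathbb H$,
and a further orthogonal element would both commute and anticommute with $uj$. Finally $S\cong K^n$
isometrically (`exists_isometryEquiv_pow`), which gives $N_{(3)},N_{(4)},N_{(5)}$.

In (b), $N_{(0)},N_{(1)},N_{(3)},N_{(4)}$ all have $d_{12}=d_{02}$, and the exceptional algebras are
the members of the other two families where this fails. -/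

theorem LinearMap.inner_map_map_of_norm_map {E F : Type*} [NormedAddCommGroup E]
    [InnerProductSpace ℝ E] [NormedAddCommGroup F] [InnerProductSpace ℝ F] {T : E →ₗ[ℝ] F} {c : ℝ}
    (hT : ∀ x, ‖T x‖ = c * ‖x‖) (x y : E) : ⟪T x, T y⟫_ℝ = c ^ 2 * ⟪x, y⟫_ℝ := by
  rw [real_inner_eq_norm_add_mul_self_sub_norm_mul_self_sub_norm_mul_self_div_two,
    real_inner_eq_norm_add_mul_self_sub_norm_mul_self_sub_norm_mul_self_div_two, ← map_add,
    hT, hT, hT]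
  ring

/-- A bilinear map with `‖m x y‖ = ‖x‖ ‖y‖`. -/
def IsometricMul {V X Y : Type*} [NormedAddCommGroup V] [InnerProductSpace ℝ V]
    [NormedAddCommGroup X] [InnerProductSpace ℝ X] [NormedAddCommGroup Y] [InnerProductSpace ℝ Y]
    (m : V →ₗ[ℝ] X →ₗ[ℝ] Y) : Prop :=
  ∀ v x, ‖m v x‖ = ‖v‖ * ‖x‖

namespace IsometricMul

variable {V X Y : Type*} [NormedAddCommGroup V] [InnerProductSpace ℝ V]
  [NormedAddCommGroup X] [InnerProductSpace ℝ X] [NormedAddCommGroup Y] [InnerProductSpace ℝ Y]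
  {m : V →ₗ[ℝ] X →ₗ[ℝ] Y}

theorem flip (hm : IsometricMul m) : IsometricMul m.flip := fun x v => by
  rw [LinearMap.flip_apply, hm, mul_comm]

theorem inner_left (hm : IsometricMul m) (v : V) (x y : X) :
    ⟪m v x, m v y⟫_ℝ = ‖v‖ ^ 2 * ⟪x, y⟫_ℝ :=
  LinearMap.inner_map_map_of_norm_map (hm v) x y

theorem inner_right (hm : IsometricMul m) (v w : V) (x : X) :
    ⟪m v x, m w x⟫_ℝ = ⟪v, w⟫_ℝ * ‖x‖ ^ 2 := by
  have := hm.flip.inner_left x v w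
  simpa [mul_comm] using this

/-- Isometric products have no zero divisors. The injectivity statements, dimension inequalities and
non-vanishing of components all come from this. -/
theorem eq_zero_of_apply (hm : IsometricMul m) {v : V} {x : X} (hx : x ≠ 0) (h : m v x = 0) :
    v = 0 := by
  have h1 := hm v x
  rw [h, norm_zero] at h1
  simpa [hx] using h1.symm

theorem injective_left (hm : IsometricMul m) {v : V} (hv : v ≠ 0) :
    Function.Injective (m v) := by
  refine (injective_iff_map_eq_zero _).2 fun x hx => ?_
  exact hm.flip.eq_zero_of_apply hv hx

theorem injective [Nontrivial X] (hm : IsometricMul m) : Function.Injective m := by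
  obtain ⟨x, hx⟩ := exists_ne (0 : X)
  refine (injective_iff_map_eq_zero _).2 fun v hv => hm.eq_zero_of_apply hx ?_
  rw [hv, LinearMap.zero_apply]

theorem finrank_le [FiniteDimensional ℝ Y] [Nontrivial V]
    (hm : IsometricMul m) : Module.finrank ℝ X ≤ Module.finrank ℝ Y := by
  obtain ⟨v, hv⟩ := exists_ne (0 : V)
  exact LinearMap.finrank_le_finrank_of_injective (hm.injective_left hv)

theorem nontrivial [Nontrivial V] [Nontrivial X] (hm : IsometricMul m) : Nontrivial Y := by
  obtain ⟨v, hv⟩ := exists_ne (0 : V)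
  exact (hm.injective_left hv).nontrivial

/-- Equality of dimensions permits division: every element of $Y$ is a multiple of a given $v\ne0$.
-/
theorem surjective_left [FiniteDimensional ℝ X] [FiniteDimensional ℝ Y] (hm : IsometricMul m)
    (h : Module.finrank ℝ X = Module.finrank ℝ Y) {v : V} (hv : v ≠ 0) :
    Function.Surjective (m v) :=
  (LinearMap.injective_iff_surjective_of_finrank_eq_finrank h).1 (hm.injective_left hv)

/-- Multiplication by a unit vector, as an isometry. -/
def leftIsometry (hm : IsometricMul m) {v : V} (hv : ‖v‖ = 1) : X →ₗᵢ[ℝ] Y :=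
  ⟨m v, fun x => by rw [hm, hv, one_mul]⟩

/-- Multiplication by a unit vector between spaces of the same dimension. -/
def leftEquiv [FiniteDimensional ℝ X] [FiniteDimensional ℝ Y] (hm : IsometricMul m)
    (h : Module.finrank ℝ X = Module.finrank ℝ Y) {v : V} (hv : ‖v‖ = 1) : X ≃ₗᵢ[ℝ] Y :=
  (hm.leftIsometry hv).toLinearIsometryEquiv h

end IsometricMul

theorem exists_norm_one (E : Type*) [NormedAddCommGroup E] [InnerProductSpace ℝ E] [Nontrivial E] :
    ∃ e : E, ‖e‖ = 1 :=
  _root_.exists_norm_eq E zero_le_one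

/-- A unit vector in the orthogonal complement of a proper subspace. -/
theorem Submodule.exists_norm_one_orthogonal {E : Type*} [NormedAddCommGroup E]
    [InnerProductSpace ℝ E] [FiniteDimensional ℝ E] {W : Submodule ℝ E} (hW : W ≠ ⊤) :
    ∃ e : E, ‖e‖ = 1 ∧ ∀ w ∈ W, ⟪w, e⟫_ℝ = 0 := by
  have h : Wᗮ ≠ ⊥ := fun h => hW ((Submodule.orthogonal_eq_bot_iff).1 h)
  have : Nontrivial Wᗮ := Submodule.nontrivial_iff_ne_bot.2 h
  obtain ⟨e, he⟩ := exists_norm_one Wᗮ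
  exact ⟨e, he, fun w hw => (Submodule.mem_orthogonal _ _).1 e.2 w hw⟩

/-! ### Division algebras acting by similarities -/

section FreeModule

variable {K : Type} [NormedDivisionRing K] [NormedAlgebra ℝ K]
  {S : Type*} [NormedAddCommGroup S] [InnerProductSpace ℝ S] [FiniteDimensional ℝ S]

/-- An isometric copy of `K^n` that does not fill the space extends to one of `K^(n+1)`. -/
theorem exists_isometry_pow_succ
    (ρ : K →ₐ[ℝ] Module.End ℝ S) (hρ : ∀ k s, ‖ρ k s‖ = ‖k‖ * ‖s‖) {n : ℕ}
    (f : (PiLp 2 fun _ : Fin n => K) →ₗᵢ[ℝ] S)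
    (hf : ∀ k x, f (WithLp.toLp 2 fun t => k * x t) = ρ k (f x))
    (hr : LinearMap.range f.toLinearMap ≠ ⊤) :
    ∃ g : (PiLp 2 fun _ : Fin (n + 1) => K) →ₗᵢ[ℝ] S,
      ∀ k x, g (WithLp.toLp 2 fun t => k * x t) = ρ k (g x) := by
  obtain ⟨e, he, horth⟩ := Submodule.exists_norm_one_orthogonal hr
  -- The whole line $Ke$ is orthogonal to the range of `f`: write $f(x)=k\,f(k^{-1}x)$ and cancel
  -- the similarity $\rho(k)$, which only scales inner products.
  have h0 : ∀ x k, ⟪f x, ρ k e⟫_ℝ = 0 := by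
    intro x k
    by_cases hk : k = 0
    · simp [hk]
    have hx : f x = ρ k (f (WithLp.toLp 2 fun t => k⁻¹ * x t)) := by
      rw [← hf]
      congr 1
      ext t
      simp [hk]
    rw [hx, LinearMap.inner_map_map_of_norm_map (hρ k), horth (f _) ⟨_, rfl⟩, mul_zero]
  let g : (PiLp 2 fun _ : Fin (n + 1) => K) →ₗ[ℝ] S :=
    { toFun := fun x => f (WithLp.toLp 2 fun t => x t.succ) + ρ (x 0) e
      map_add' := fun x y => by
        have h : (WithLp.toLp 2 fun t : Fin n => (x + y) t.succ) =
            (WithLp.toLp 2 fun t : Fin n => x t.succ) + WithLp.toLp 2 fun t : Fin n => y t.succ :=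
          rfl
        rw [h, map_add, PiLp.add_apply, map_add, LinearMap.add_apply]
        abel
      map_smul' := fun c x => by
        have h : (WithLp.toLp 2 fun t : Fin n => (c • x) t.succ) =
            c • WithLp.toLp 2 fun t : Fin n => x t.succ := rfl
        rw [h, map_smul, PiLp.smul_apply, map_smul, LinearMap.smul_apply, ← smul_add]
        rfl }
  refine ⟨⟨g, fun x => ?_⟩, fun k x => ?_⟩
  · have h1 : ‖g x‖ ^ 2 = ‖x‖ ^ 2 := by
      change ‖f (WithLp.toLp 2 fun t => x t.succ) + ρ (x 0) e‖ ^ 2 = _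
      rw [norm_add_sq_real, h0, f.norm_map, hρ, he, PiLp.norm_sq_eq_of_L2, PiLp.norm_sq_eq_of_L2,
        Fin.sum_univ_succ]
      simp [add_comm]
    exact (sq_eq_sq₀ (norm_nonneg _) (norm_nonneg _)).1 h1
  · change f (WithLp.toLp 2 fun t => k * x t.succ) + ρ (k * x 0) e =
      ρ k (f (WithLp.toLp 2 fun t => x t.succ) + ρ (x 0) e)
    rw [map_add, ← hf, map_mul]
    rfl

/-- A Euclidean space on which `K` acts by similarities is isometric to some `K^n`. -/
theorem exists_isometryEquiv_pow [FiniteDimensional ℝ K]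
    (ρ : K →ₐ[ℝ] Module.End ℝ S) (hρ : ∀ k s, ‖ρ k s‖ = ‖k‖ * ‖s‖) :
    ∃ (n : ℕ) (ψ : S ≃ₗᵢ[ℝ] PiLp 2 fun _ : Fin n => K),
      ∀ k s, ψ (ρ k s) = WithLp.toLp 2 fun t => k * ψ s t := by
  let P : ℕ → Prop := fun n => ∃ f : (PiLp 2 fun _ : Fin n => K) →ₗᵢ[ℝ] S,
    ∀ k x, f (WithLp.toLp 2 fun t => k * x t) = ρ k (f x)
  have hP0 : P 0 := by
    refine ⟨⟨0, fun x => ?_⟩, fun k x => ?_⟩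
    · rw [Subsingleton.elim x 0]
      simp
    · change (0 : S) = ρ k 0
      simp
  have hbd : ∀ n, P n → n ≤ Module.finrank ℝ S := by
    rintro n ⟨f, -⟩
    have h1 := LinearMap.finrank_le_finrank_of_injective (f := f.toLinearMap) f.injective
    have h2 : Module.finrank ℝ (PiLp 2 fun _ : Fin n => K) = n * Module.finrank ℝ K := by
      rw [(WithLp.linearEquiv 2 ℝ (Fin n → K)).finrank_eq, Module.finrank_pi_fintype]
      simp
    have h3 : 0 < Module.finrank ℝ K := Module.finrank_pos
    nlinarith
  -- The last $n$ for which $K^n$ embeds; the dimension of `S` bounds it, and by the extension step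
  -- its copy must fill `S`.
  obtain ⟨n, hn, hn'⟩ : ∃ n, P n ∧ ¬ P (n + 1) := by
    by_contra! h
    have h1 : ∀ n, P n := fun n => Nat.rec hP0 (fun n ih => h n ih) n
    have := hbd _ (h1 (Module.finrank ℝ S + 1))
    omega
  obtain ⟨f, hf⟩ := hn
  have hr : LinearMap.range f.toLinearMap = ⊤ := by
    by_contra hr
    exact hn' (exists_isometry_pow_succ ρ hρ f hf hr)
  let ψ := LinearIsometryEquiv.ofSurjective f (LinearMap.range_eq_top.1 hr)
  refine ⟨n, ψ.symm, fun k s => ?_⟩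
  rw [LinearIsometryEquiv.symm_apply_eq]
  change _ = f _
  rw [hf]
  congr 1
  exact (ψ.apply_symm_apply s).symm

end FreeModule

/-! ### Spaces of similarities containing the identity -/

namespace IsometricMul

variable {E S : Type*} [NormedAddCommGroup E] [InnerProductSpace ℝ E]
  [NormedAddCommGroup S] [InnerProductSpace ℝ S] {β : E →ₗ[ℝ] Module.End ℝ S}

/-- Polarisation of `inner_right` in the vector of $S$. With $y=e$ acting as the identity, it makes
every $x\perp e$ skew-adjoint, hence with square $-\|x\|^2$, and orthogonal such elements
anticommute. -/
theorem inner_polar (hβ : IsometricMul β) (x y : E) (s t : S) :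
    ⟪β x s, β y t⟫_ℝ + ⟪β x t, β y s⟫_ℝ = 2 * ⟪x, y⟫_ℝ * ⟪s, t⟫_ℝ := by
  have h := hβ.inner_right x y (s + t)
  have h1 := hβ.inner_right x y s
  have h2 := hβ.inner_right x y t
  rw [map_add, map_add, inner_add_left, inner_add_right, inner_add_right, norm_add_sq_real] at h
  linarith

variable {e : E}

theorem skew_of_orthogonal (hβ : IsometricMul β) (he : β e = 1) {x : E} (hx : ⟪x, e⟫_ℝ = 0)
    (s t : S) : ⟪β x s, t⟫_ℝ = -⟪s, β x t⟫_ℝ := by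
  have h := hβ.inner_polar x e s t
  rw [he, hx] at h
  simp only [Module.End.one_apply] at h
  rw [real_inner_comm _ s]
  linarith

theorem mul_self_of_orthogonal (hβ : IsometricMul β) (he : β e = 1) {x : E} (hx : ⟪x, e⟫_ℝ = 0) :
    β x * β x = -(‖x‖ ^ 2) • (1 : Module.End ℝ S) := by
  refine LinearMap.ext fun s => ext_inner_right ℝ fun t => ?_
  rw [Module.End.mul_apply, hβ.skew_of_orthogonal he hx, hβ.inner_left, LinearMap.smul_apply,
    Module.End.one_apply, real_inner_smul_left]
  ring

theorem mul_add_mul_of_orthogonal (hβ : IsometricMul β) (he : β e = 1) {x y : E}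
    (hx : ⟪x, e⟫_ℝ = 0) (hy : ⟪y, e⟫_ℝ = 0) (hxy : ⟪x, y⟫_ℝ = 0) :
    β x * β y = -(β y * β x) := by
  have h := hβ.mul_self_of_orthogonal he (x := x + y) (by rw [inner_add_left, hx, hy, add_zero])
  rw [map_add, norm_add_sq_real, hxy, add_mul, mul_add, mul_add,
    hβ.mul_self_of_orthogonal he hx, hβ.mul_self_of_orthogonal he hy] at h
  have h2 : β x * β y + β y * β x = 0 := by
    have h3 : β x * β y + β y * β x = (-(‖x‖ ^ 2 + 2 * 0 + ‖y‖ ^ 2)) • (1 : Module.End ℝ S)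
        - -(‖x‖ ^ 2) • (1 : Module.End ℝ S) - -(‖y‖ ^ 2) • (1 : Module.End ℝ S) := by
      rw [← h]
      abel
    rw [h3]
    module
  exact eq_neg_of_add_eq_zero_left h2

theorem norm_unit [Nontrivial S] (hβ : IsometricMul β) (he : β e = 1) : ‖e‖ = 1 := by
  obtain ⟨s, hs⟩ := exists_norm_one S
  have := hβ e s
  rw [he, Module.End.one_apply, hs] at this
  linarith

/-- Inner products in $E$ are tested on operators, so orthogonality of an element known only through
its action can be checked in $S$. -/
theorem inner_eq [Nontrivial S] (hβ : IsometricMul β) {x y : E} {c : ℝ}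
    (h : ∀ s, ⟪β x s, β y s⟫_ℝ = c * ‖s‖ ^ 2) : ⟪x, y⟫_ℝ = c := by
  obtain ⟨s, hs⟩ := exists_norm_one S
  have h1 := h s
  rw [hβ.inner_right, hs] at h1
  linarith

end IsometricMul

section Core

variable {E S : Type*} [NormedAddCommGroup E] [InnerProductSpace ℝ E]
  [NormedAddCommGroup S] [InnerProductSpace ℝ S] [Nontrivial S] {β : E →ₗ[ℝ] Module.End ℝ S}
  {e u : E}

/-- Similarities `1, u` with `u` orthogonal to `1` span a copy of `ℂ`. -/
theorem exists_complex_action (hβ : IsometricMul β) (he : β e = 1) (hu : ‖u‖ = 1)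
    (hue : ⟪u, e⟫_ℝ = 0) :
    ∃ (ρ : ℂ →ₐ[ℝ] Module.End ℝ S) (φ : ℂ →ₗᵢ[ℝ] E), (∀ z, β (φ z) = ρ z) ∧
      ∀ z, φ z = z.re • e + z.im • u := by
  have hsq : β u * β u = -1 := by
    rw [hβ.mul_self_of_orthogonal he hue, hu]
    module
  have he1 := hβ.norm_unit he
  let φ : ℂ →ₗ[ℝ] E :=
    { toFun := fun z => z.re • e + z.im • u
      map_add' := fun z w => by rw [Complex.add_re, Complex.add_im]; module
      map_smul' := fun c z => by
        simp only [Complex.smul_re, Complex.smul_im, smul_eq_mul, RingHom.id_apply]; module }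
  refine ⟨Complex.liftAux (β u) hsq, ⟨φ, fun z => ?_⟩, fun z => ?_, fun z => rfl⟩
  · refine (sq_eq_sq₀ (norm_nonneg _) (norm_nonneg _)).1 ?_
    change ‖z.re • e + z.im • u‖ ^ 2 = _
    rw [norm_add_sq_real, norm_smul, norm_smul, he1, hu, real_inner_smul_left,
      real_inner_smul_right, real_inner_comm, hue, Complex.sq_norm, Complex.normSq_apply,
      Real.norm_eq_abs, Real.norm_eq_abs, mul_one, mul_one, sq_abs, sq_abs]
    ring
  · change β (z.re • e + z.im • u) = _
    rw [Complex.liftAux_apply, map_add, map_smul, map_smul, he, Algebra.algebraMap_eq_smul_one]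

/-- Anticommuting similarities `u, j` together with `k = u j` span a copy of `ℍ`. -/
theorem exists_quaternion_action [FiniteDimensional ℝ E] (hβ : IsometricMul β) (he : β e = 1)
    (hu : ‖u‖ = 1) (hue : ⟪u, e⟫_ℝ = 0) {j k : E} (hj : ‖j‖ = 1) (hje : ⟪j, e⟫_ℝ = 0) (huj : ⟪u, j⟫_ℝ = 0)
    (hk : β k = β u * β j) :
    ∃ (ρ : ℍ[ℝ] →ₐ[ℝ] Module.End ℝ S) (φ : ℍ[ℝ] ≃ₗᵢ[ℝ] E), ∀ q, β (φ q) = ρ q := by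
  have he1 := hβ.norm_unit he
  have husq : β u * β u = -1 := by
    rw [hβ.mul_self_of_orthogonal he hue, hu]
    module
  have hjsq : β j * β j = -1 := by
    rw [hβ.mul_self_of_orthogonal he hje, hj]
    module
  have hanti := hβ.mul_add_mul_of_orthogonal he hue hje huj
  have hk1 : ‖k‖ = 1 := by
    obtain ⟨s, hs⟩ := exists_norm_one S
    have h := hβ k s
    rw [hk, Module.End.mul_apply, hβ, hβ, hu, hj, hs] at h
    linarith
  have hju : ⟪j, u⟫_ℝ = 0 := by rw [real_inner_comm, huj]
  -- In this and the next two facts the inner product of $ujs$ with $s$, $us$, $js$ reduces to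
  -- $-\langle js,us\rangle$, $\langle js,s\rangle$ and $\langle u(js),js\rangle$, all zero since
  -- $u,j,e$ are pairwise orthogonal.
  have hke : ⟪k, e⟫_ℝ = 0 := hβ.inner_eq fun s => by
    rw [hk, he, Module.End.mul_apply, Module.End.one_apply, hβ.skew_of_orthogonal he hue,
      hβ.inner_right, hju, zero_mul, neg_zero]
  have hku : ⟪k, u⟫_ℝ = 0 := hβ.inner_eq fun s => by
    rw [hk, Module.End.mul_apply, hβ.inner_left]
    have h := hβ.inner_right j e s
    rw [he, Module.End.one_apply, hje] at h
    rw [h]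
    ring
  have hkj : ⟪k, j⟫_ℝ = 0 := hβ.inner_eq fun s => by
    rw [hk, Module.End.mul_apply]
    have h := hβ.inner_right u e (β j s)
    rw [he, Module.End.one_apply, hue] at h
    rw [h]
    ring
  let Q : QuaternionAlgebra.Basis (Module.End ℝ S) (-1 : ℝ) 0 (-1) :=
    { i := β u
      j := β j
      k := β u * β j
      i_mul_i := by rw [husq]; module
      j_mul_j := by rw [hjsq]; module
      i_mul_j := rfl
      j_mul_i := by rw [hanti]; module }
  let φ : ℍ[ℝ] →ₗ[ℝ] E :=
    { toFun := fun q => q.re • e + q.imI • u + q.imJ • j + q.imK • k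
      map_add' := fun z w => by
        simp only [Quaternion.re_add, Quaternion.imI_add, Quaternion.imJ_add, Quaternion.imK_add]
        module
      map_smul' := fun c z => by
        simp only [Quaternion.re_smul, Quaternion.imI_smul, Quaternion.imJ_smul,
          Quaternion.imK_smul, smul_eq_mul, RingHom.id_apply]
        module }
  have hφ : ∀ q, φ q = q.re • e + q.imI • u + q.imJ • j + q.imK • k := fun q => rfl
  have hφn : ∀ q, ‖φ q‖ = ‖q‖ := fun q => by
    refine (sq_eq_sq₀ (norm_nonneg _) (norm_nonneg _)).1 ?_
    rw [hφ, sq ‖q‖, ← Quaternion.normSq_eq_norm_mul_self, Quaternion.normSq_def']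
    have hue' : ⟪e, u⟫_ℝ = 0 := by rw [real_inner_comm, hue]
    have hje' : ⟪e, j⟫_ℝ = 0 := by rw [real_inner_comm, hje]
    have hke' : ⟪e, k⟫_ℝ = 0 := by rw [real_inner_comm, hke]
    have hku' : ⟪u, k⟫_ℝ = 0 := by rw [real_inner_comm, hku]
    have hkj' : ⟪j, k⟫_ℝ = 0 := by rw [real_inner_comm, hkj]
    simp only [norm_add_sq_real, norm_smul, he1, hu, hj, hk1, inner_add_left, real_inner_smul_left,
      real_inner_smul_right, hue', hje', hke', huj, hku', hkj', Real.norm_eq_abs, mul_one, sq_abs]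
    ring
  have hφβ : ∀ q, β (φ q) = QuaternionAlgebra.lift Q q := fun q => by
    change _ = algebraMap ℝ (Module.End ℝ S) q.re + q.imI • β u + q.imJ • β j + q.imK • (β u * β j)
    rw [hφ, map_add, map_add, map_add, map_smul, map_smul, map_smul,
      map_smul, he, hk, Algebra.algebraMap_eq_smul_one]
  -- A unit $b\perp e,u,j,k$ anticommutes with $u$ and $j$, hence commutes with $k=uj$; being
  -- orthogonal to $k$ it also anticommutes with it. So $kb=0$, impossible for a product of
  -- similarities of ratio 1.
  have hsurj : LinearMap.range φ = ⊤ := by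
    by_contra hr
    obtain ⟨b, hb, horth⟩ := Submodule.exists_norm_one_orthogonal hr
    have hbe : ⟪b, e⟫_ℝ = 0 := by
      rw [real_inner_comm]
      exact horth e ⟨⟨1, 0, 0, 0⟩, by
      change (1 : ℝ) • e + (0 : ℝ) • u + (0 : ℝ) • j + (0 : ℝ) • k = e
      module⟩
    have hub : ⟪u, b⟫_ℝ = 0 := horth u ⟨⟨0, 1, 0, 0⟩, by
      change (0 : ℝ) • e + (1 : ℝ) • u + (0 : ℝ) • j + (0 : ℝ) • k = u
      module⟩
    have hjb : ⟪j, b⟫_ℝ = 0 := horth j ⟨⟨0, 0, 1, 0⟩, by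
      change (0 : ℝ) • e + (0 : ℝ) • u + (1 : ℝ) • j + (0 : ℝ) • k = j
      module⟩
    have hkb : ⟪k, b⟫_ℝ = 0 := horth k ⟨⟨0, 0, 0, 1⟩, by
      change (0 : ℝ) • e + (0 : ℝ) • u + (0 : ℝ) • j + (1 : ℝ) • k = k
      module⟩
    have h1 := hβ.mul_add_mul_of_orthogonal he hue hbe hub
    have h2 := hβ.mul_add_mul_of_orthogonal he hje hbe hjb
    have h3 := hβ.mul_add_mul_of_orthogonal he hke hbe hkb
    have h4 : β k * β b = β b * β k := by
      rw [hk, mul_assoc, h2, mul_neg, ← mul_assoc, h1, neg_mul, neg_neg, mul_assoc]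
    rw [← h4] at h3
    have h5 : (2 : ℝ) • (β k * β b) = 0 := by
      rw [two_smul]
      exact add_eq_zero_iff_eq_neg.2 h3
    rw [smul_eq_zero_iff_right two_ne_zero] at h5
    obtain ⟨s, hs⟩ := exists_norm_one S
    have h6 : ‖(β k * β b) s‖ = 1 := by
      rw [Module.End.mul_apply, hβ, hβ, hk1, hb, hs]
      norm_num
    rw [h5] at h6
    simp at h6
  exact ⟨QuaternionAlgebra.lift Q, LinearIsometryEquiv.ofSurjective ⟨φ, hφn⟩
    (LinearMap.range_eq_top.1 hsurj), hφβ⟩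

/-- A space of similarities containing `1` and closed under multiplication by some `u`
orthogonal to `1` is a copy of `ℂ` or of `ℍ`. -/
theorem complex_or_quaternion_action [FiniteDimensional ℝ E] (hβ : IsometricMul β) (he : β e = 1) (hu : ‖u‖ = 1)
    (hue : ⟪u, e⟫_ℝ = 0)
    (hclosed : (∀ x, ∃ y, β y = β u * β x) ∨ ∀ x, ∃ y, β y = β x * β u) :
    (∃ (ρ : ℂ →ₐ[ℝ] Module.End ℝ S) (φ : ℂ ≃ₗᵢ[ℝ] E), ∀ z, β (φ z) = ρ z) ∨
    ∃ (ρ : ℍ[ℝ] →ₐ[ℝ] Module.End ℝ S) (φ : ℍ[ℝ] ≃ₗᵢ[ℝ] E), ∀ q, β (φ q) = ρ q := by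
  obtain ⟨ρ, φ, h1, h2⟩ := exists_complex_action hβ he hu hue
  by_cases hr : LinearMap.range φ.toLinearMap = ⊤
  · exact .inl ⟨ρ, LinearIsometryEquiv.ofSurjective φ (LinearMap.range_eq_top.1 hr), h1⟩
  · obtain ⟨j, hj, horth⟩ := Submodule.exists_norm_one_orthogonal hr
    have hje : ⟪j, e⟫_ℝ = 0 := by
      rw [real_inner_comm]
      exact horth e ⟨⟨1, 0⟩, by simp [h2]⟩
    have huj : ⟪u, j⟫_ℝ = 0 := horth u ⟨⟨0, 1⟩, by simp [h2]⟩
    obtain ⟨k, hk⟩ : ∃ k, β k = β u * β j := by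
      rcases hclosed with h | h
      · exact h j
      · obtain ⟨y, hy⟩ := h j
        -- Right stability gives $ju$; since $u$ and $j$ anticommute, its negative is $uj$.
        refine ⟨-y, ?_⟩
        rw [map_neg, hy, hβ.mul_add_mul_of_orthogonal he hue hje huj]
    exact .inr (exists_quaternion_action hβ he hu hue hj hje huj hk)

end Core

/-! ### Clifford modules from isometric products -/

namespace IsometricMul

variable {V X Y : Type*} [NormedAddCommGroup V] [InnerProductSpace ℝ V]
  [NormedAddCommGroup X] [InnerProductSpace ℝ X] [FiniteDimensional ℝ X]
  [NormedAddCommGroup Y] [InnerProductSpace ℝ Y] [FiniteDimensional ℝ Y]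
  {m : V →ₗ[ℝ] X →ₗ[ℝ] Y}

/-- The negative of the adjoint, as a bilinear map. -/
def negAdjoint (m : V →ₗ[ℝ] X →ₗ[ℝ] Y) : V →ₗ[ℝ] Y →ₗ[ℝ] X :=
  LinearMap.mk₂ ℝ (fun v y => -LinearMap.adjoint (m v) y)
    (by intros; simp only [map_add, LinearMap.add_apply]; abel)
    (by intros; simp only [map_smulₛₗ, LinearMap.smul_apply, smul_neg]; rfl)
    (by intros; simp only [map_add]; abel)
    (by intros; simp only [map_smul, smul_neg])

theorem inner_negAdjoint (m : V →ₗ[ℝ] X →ₗ[ℝ] Y) (v : V) (x : X) (y : Y) :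
    ⟪m v x, y⟫_ℝ = -⟪x, negAdjoint m v y⟫_ℝ := by
  change _ = -⟪x, -LinearMap.adjoint (m v) y⟫_ℝ
  rw [inner_neg_right, neg_neg, LinearMap.adjoint_inner_right]

theorem negAdjoint_apply_apply (hm : IsometricMul m) (v : V) (x : X) :
    negAdjoint m v (m v x) = (-(‖v‖ * ‖v‖)) • x := by
  refine ext_inner_left ℝ fun z => ?_
  have h := inner_negAdjoint m v z (m v x)
  rw [hm.inner_left] at h
  rw [real_inner_smul_right]
  linarith

/-- The negative adjoint always satisfies the Clifford relation on one side. Equal dimensions make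
$m(v,\cdot)$ onto, which transfers the relation to the other side. -/
theorem apply_negAdjoint_apply (hm : IsometricMul m)
    (h : Module.finrank ℝ X = Module.finrank ℝ Y) (v : V) (y : Y) :
    m v (negAdjoint m v y) = (-(‖v‖ * ‖v‖)) • y := by
  by_cases hv : v = 0
  · simp [hv]
  · obtain ⟨x, rfl⟩ := hm.surjective_left h hv y
    rw [hm.negAdjoint_apply_apply, map_smul]

end IsometricMul

namespace GradedCliffordModule

variable {V S0 S1 : EuclSp.{u}}

/-- The operators $(s,t)\mapsto(q_vt,p_vs)$ have square $-\|v\|^2$, so the universal property of the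
Clifford algebra applies. -/
theorem exists_of_skew (p : V →ₗ[ℝ] S0 →ₗ[ℝ] S1) (q : V →ₗ[ℝ] S1 →ₗ[ℝ] S0)
    (hqp : ∀ v s, q v (p v s) = (-(‖v‖ * ‖v‖)) • s)
    (hpq : ∀ v t, p v (q v t) = (-(‖v‖ * ‖v‖)) • t)
    (hskew : ∀ v s t, ⟪p v s, t⟫_ℝ = -⟪s, q v t⟫_ℝ) :
    ∃ M : GradedCliffordModule V S0 S1, M.mulZero = p ∧ M.mulOne = q := by
  let f : V →ₗ[ℝ] Module.End ℝ (S0 × S1) :=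
    LinearMap.mk₂ ℝ (fun v x => (q v x.2, p v x.1))
      (by intros; simp) (by intros; simp) (by intros; simp) (by intros; simp)
  have hf : ∀ v x, f v x = (q v x.2, p v x.1) := fun _ _ => rfl
  let F := CliffordAlgebra.lift (negSq V) ⟨f, fun v => by
    refine LinearMap.ext fun x => ?_
    rw [Module.End.mul_apply, hf, hf, hqp, hpq, negSq_apply, Module.algebraMap_end_apply]
    rfl⟩
  have hF : ∀ v x, F (CliffordAlgebra.ι (negSq V) v) x = (q v x.2, p v x.1) := fun v x => by
    simp only [F, CliffordAlgebra.lift_ι_apply, hf]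
  refine ⟨⟨F, fun v s => ⟨p v s, by simp [hF]⟩, fun v t => ⟨q v t, by simp [hF]⟩,
    fun v s t => by simp only [hF, hskew]⟩, ?_, ?_⟩
  · refine LinearMap.ext fun v => LinearMap.ext fun s => ?_
    exact congrArg Prod.snd (hF v (s, 0))
  · refine LinearMap.ext fun v => LinearMap.ext fun t => ?_
    exact congrArg Prod.fst (hF v (0, t))

theorem exists_mulZero_eq {m : V →ₗ[ℝ] S0 →ₗ[ℝ] S1} (hm : IsometricMul m)
    (h : Module.finrank ℝ S0 = Module.finrank ℝ S1) :
    ∃ M : GradedCliffordModule V S0 S1, M.mulZero = m := by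
  obtain ⟨M, hM, -⟩ := exists_of_skew m (IsometricMul.negAdjoint m) hm.negAdjoint_apply_apply
    (hm.apply_negAdjoint_apply h) (IsometricMul.inner_negAdjoint m)
  exact ⟨M, hM⟩

theorem exists_mulOne_eq {m : V →ₗ[ℝ] S1 →ₗ[ℝ] S0} (hm : IsometricMul m)
    (h : Module.finrank ℝ S1 = Module.finrank ℝ S0) :
    ∃ M : GradedCliffordModule V S0 S1, M.mulOne = m := by
  obtain ⟨M, -, hM⟩ := exists_of_skew (IsometricMul.negAdjoint m) m
    (hm.apply_negAdjoint_apply h) hm.negAdjoint_apply_apply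
    (fun v s t => by
      have h := IsometricMul.inner_negAdjoint m v t s
      have h1 := real_inner_comm (m v t) s
      have h2 := real_inner_comm t (IsometricMul.negAdjoint m v s)
      linarith)
  exact ⟨M, hM⟩

theorem finrank_eq [Nontrivial V] (M : GradedCliffordModule V S0 S1) :
    Module.finrank ℝ S0 = Module.finrank ℝ S1 :=
  le_antisymm (IsometricMul.finrank_le (m := M.mulZero) M.norm_mulZero)
    (IsometricMul.finrank_le (m := M.mulOne) M.norm_mulOne)

end GradedCliffordModule

theorem CliffordAlgebra.commute_of_commute_ι {V A : Type*} [AddCommGroup V] [Module ℝ V]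
    {Q : QuadraticForm ℝ V} [Ring A] [Algebra ℝ A] (F : CliffordAlgebra Q →ₐ[ℝ] A) {z : A}
    (h : ∀ v, Commute (F (CliffordAlgebra.ι Q v)) z) (x : CliffordAlgebra Q) :
    Commute (F x) z := by
  induction x using CliffordAlgebra.induction with
  | algebraMap r => rw [AlgHom.commutes]; exact Algebra.commutes r z
  | ι v => exact h v
  | mul a b ha hb => rw [map_mul]; exact ha.mul_left hb
  | add a b ha hb => rw [map_add]; exact ha.add_left hb

/-- An operator whose square is a non-zero scalar is injective. This form serves the components of a
bigraded module between which no multiplication map has been named. -/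
theorem LinearMap.finrank_le_finrank_of_odd {X Y T : Type*} [AddCommGroup X] [Module ℝ X]
    [AddCommGroup Y] [Module ℝ Y] [FiniteDimensional ℝ Y] [AddCommGroup T] [Module ℝ T]
    {A : Module.End ℝ T} {i : X →ₗ[ℝ] T} {j : Y →ₗ[ℝ] T} {c : ℝ} (hc : c ≠ 0)
    (hA : ∀ x, A (A x) = c • x) (hi : Function.Injective i) (hj : Function.Injective j)
    (h : ∀ x, ∃ y, A (i x) = j y) : Module.finrank ℝ X ≤ Module.finrank ℝ Y := by
  let B := (LinearEquiv.ofInjective j hj).symm.toLinearMap ∘ₗ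
    (A ∘ₗ i).codRestrict (LinearMap.range j) (fun x => by
      obtain ⟨y, hy⟩ := h x
      exact ⟨y, hy.symm⟩)
  have hB : ∀ x, j (B x) = A (i x) := fun x =>
    congrArg Subtype.val ((LinearEquiv.ofInjective j hj).apply_symm_apply ⟨A (i x), _⟩)
  refine LinearMap.finrank_le_finrank_of_injective (f := B) fun x y hxy => hi ?_
  have h1 : A (i x) = A (i y) := by rw [← hB, ← hB, hxy]
  have h2 := congrArg A h1
  rw [hA, hA] at h2
  exact smul_right_injective _ hc h2

namespace BigradedCliffordModule

open IsometricMul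

variable {V10 V01 S00 S10 S01 S11 : EuclSp.{u}}

/-- Only the commutation on $S^{00}$, which is what associativity provides, has to be assumed:
invertibility propagates it to the three other components, where adjoints occur. -/
theorem exists_of_commute {L0 : V10 →ₗ[ℝ] S00 →ₗ[ℝ] S10} {L1 : V10 →ₗ[ℝ] S01 →ₗ[ℝ] S11}
    {R0 : V01 →ₗ[ℝ] S00 →ₗ[ℝ] S01} {R1 : V01 →ₗ[ℝ] S10 →ₗ[ℝ] S11}
    (hL0 : IsometricMul L0) (hL1 : IsometricMul L1) (hR0 : IsometricMul R0) (hR1 : IsometricMul R1)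
    (h10 : Module.finrank ℝ S00 = Module.finrank ℝ S10)
    (h01 : Module.finrank ℝ S00 = Module.finrank ℝ S01)
    (h11 : Module.finrank ℝ S00 = Module.finrank ℝ S11)
    (hcomm : ∀ v w s, L1 v (R0 w s) = R1 w (L0 v s)) :
    ∃ M : BigradedCliffordModule V10 V01 S00 S10 S01 S11,
      M.mulLeft0 = L0 ∧ M.mulLeft1 = L1 ∧ M.mulRight0 = R0 ∧ M.mulRight1 = R1 := by
  have hl1 : Module.finrank ℝ S01 = Module.finrank ℝ S11 := by rw [← h01, h11]
  have hr1 : Module.finrank ℝ S10 = Module.finrank ℝ S11 := by rw [← h10, h11]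
  let f : V10 →ₗ[ℝ] Module.End ℝ ((S00 × S10) × (S01 × S11)) :=
    LinearMap.mk₂ ℝ (fun v x =>
      ((negAdjoint L0 v x.1.2, L0 v x.1.1), (negAdjoint L1 v x.2.2, L1 v x.2.1)))
      (by intros; simp) (by intros; simp) (by intros; simp) (by intros; simp)
  let g : V01 →ₗ[ℝ] Module.End ℝ ((S00 × S10) × (S01 × S11)) :=
    LinearMap.mk₂ ℝ (fun v x =>
      ((negAdjoint R0 v x.2.1, negAdjoint R1 v x.2.2), (R0 v x.1.1, R1 v x.1.2)))
      (by intros; simp) (by intros; simp) (by intros; simp) (by intros; simp)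
  have hf : ∀ v x, f v x =
      ((negAdjoint L0 v x.1.2, L0 v x.1.1), (negAdjoint L1 v x.2.2, L1 v x.2.1)) := fun _ _ => rfl
  have hg : ∀ v x, g v x =
      ((negAdjoint R0 v x.2.1, negAdjoint R1 v x.2.2), (R0 v x.1.1, R1 v x.1.2)) := fun _ _ => rfl
  -- For $v\ne0$ write $s=L_0(v,a)$; `hcomm` then brings both sides to $-\|v\|^2R_0(w,a)$. The next
  -- two relations use the same division.
  have hLR : ∀ v w s, negAdjoint L1 v (R1 w s) = R0 w (negAdjoint L0 v s) := by
    intro v w s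
    by_cases hv : v = 0
    · simp [hv]
    obtain ⟨a, rfl⟩ := hL0.surjective_left h10 hv s
    rw [← hcomm, hL1.negAdjoint_apply_apply, hL0.negAdjoint_apply_apply, map_smul]
  have hRL : ∀ v w s, negAdjoint R1 w (L1 v s) = L0 v (negAdjoint R0 w s) := by
    intro v w s
    by_cases hw : w = 0
    · simp [hw]
    obtain ⟨a, rfl⟩ := hR0.surjective_left h01 hw s
    rw [hcomm, hR1.negAdjoint_apply_apply, hR0.negAdjoint_apply_apply, map_smul]
  have hRR : ∀ v w s,
      negAdjoint L0 v (negAdjoint R1 w s) = negAdjoint R0 w (negAdjoint L1 v s) := by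
    intro v w s
    by_cases hv : v = 0
    · simp [hv]
    obtain ⟨a, rfl⟩ := hL1.surjective_left hl1 hv s
    rw [hRL, hL0.negAdjoint_apply_apply, hL1.negAdjoint_apply_apply, map_smul]
  let F := CliffordAlgebra.lift (negSq V10) ⟨f, fun v => by
    refine LinearMap.ext fun x => ?_
    rw [Module.End.mul_apply, hf, hf, hL0.negAdjoint_apply_apply, hL1.negAdjoint_apply_apply,
      hL0.apply_negAdjoint_apply h10, hL1.apply_negAdjoint_apply hl1, negSq_apply,
      Module.algebraMap_end_apply]
    rfl⟩
  let G := CliffordAlgebra.lift (negSq V01) ⟨g, fun v => by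
    refine LinearMap.ext fun x => ?_
    rw [Module.End.mul_apply, hg, hg, hR0.negAdjoint_apply_apply, hR1.negAdjoint_apply_apply,
      hR0.apply_negAdjoint_apply h01, hR1.apply_negAdjoint_apply hr1, negSq_apply,
      Module.algebraMap_end_apply]
    rfl⟩
  have hFG : ∀ x y, Commute (F x) (G y) := fun x y =>
    CliffordAlgebra.commute_of_commute_ι F (fun v =>
      (CliffordAlgebra.commute_of_commute_ι G (fun w => by
        refine LinearMap.ext fun x => ?_
        simp only [F, G, CliffordAlgebra.lift_ι_apply, Module.End.mul_apply, hf, hg, hLR, hRL, hRR,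
          hcomm]) y).symm) x
  let T := Algebra.TensorProduct.lift F G hFG
  have hT1 : ∀ v x, T (CliffordAlgebra.ι (negSq V10) v ⊗ₜ 1) x =
      ((negAdjoint L0 v x.1.2, L0 v x.1.1), (negAdjoint L1 v x.2.2, L1 v x.2.1)) := fun v x => by
    simp only [T, Algebra.TensorProduct.lift_tmul, map_one, mul_one, F,
      CliffordAlgebra.lift_ι_apply, hf]
  have hT2 : ∀ v x, T (1 ⊗ₜ CliffordAlgebra.ι (negSq V01) v) x =
      ((negAdjoint R0 v x.2.1, negAdjoint R1 v x.2.2), (R0 v x.1.1, R1 v x.1.2)) := fun v x => by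
    simp only [T, Algebra.TensorProduct.lift_tmul, map_one, one_mul, G,
      CliffordAlgebra.lift_ι_apply, hg]
  have hskew : ∀ {V X Y : EuclSp.{u}} (m : V →ₗ[ℝ] X →ₗ[ℝ] Y) (v : V) (x : X) (y : Y),
      ⟪negAdjoint m v y, x⟫_ℝ = -⟪y, m v x⟫_ℝ := fun m v x y => by
    rw [real_inner_comm, real_inner_comm _ y, inner_negAdjoint, neg_neg]
  refine ⟨
    { act := T
      left00 := fun w s => ⟨L0 w s, by simp [hT1]⟩
      left10 := fun w s => ⟨negAdjoint L0 w s, by simp [hT1]⟩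
      left01 := fun w s => ⟨L1 w s, by simp [hT1]⟩
      left11 := fun w s => ⟨negAdjoint L1 w s, by simp [hT1]⟩
      right00 := fun w s => ⟨R0 w s, by simp [hT2]⟩
      right01 := fun w s => ⟨negAdjoint R0 w s, by simp [hT2]⟩
      right10 := fun w s => ⟨R1 w s, by simp [hT2]⟩
      right11 := fun w s => ⟨negAdjoint R1 w s, by simp [hT2]⟩
      skew_left := fun w x y => by
        simp only [hT1, sumInner, hskew, inner_negAdjoint]
        ring
      skew_right := fun w x y => by
        simp only [hT2, sumInner, hskew, inner_negAdjoint]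
        ring }, ?_, ?_, ?_, ?_⟩
  all_goals refine LinearMap.ext fun v => LinearMap.ext fun s => ?_
  · exact congrArg (fun x => x.1.2) (hT1 v ((s, 0), (0, 0)))
  · exact congrArg (fun x => x.2.2) (hT1 v ((0, 0), (s, 0)))
  · exact congrArg (fun x => x.2.1) (hT2 v ((s, 0), (0, 0)))
  · exact congrArg (fun x => x.2.2) (hT2 v ((0, s), (0, 0)))

variable (M : BigradedCliffordModule V10 V01 S00 S10 S01 S11)

/-- The two tensor factors commute; this is associativity of $N_{(0)}$. -/
theorem mulLeft1_mulRight0 (v : V10) (w : V01) (s : S00) :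
    M.mulLeft1 v (M.mulRight0 w s) = M.mulRight1 w (M.mulLeft0 v s) := by
  obtain ⟨a, ha⟩ := M.right00 w s
  obtain ⟨b, hb⟩ := M.left00 v s
  have h1 : M.mulRight0 w s = a := congrArg (fun x => x.2.1) ha
  have h2 : M.mulLeft0 v s = b := congrArg (fun x => x.1.2) hb
  rw [h1, h2]
  change (M.act (CliffordAlgebra.ι (negSq V10) v ⊗ₜ 1) ((0, 0), (a, 0))).2.2 =
    (M.act (1 ⊗ₜ CliffordAlgebra.ι (negSq V01) w) ((0, b), (0, 0))).2.2
  rw [← ha, ← hb, ← Module.End.mul_apply, ← Module.End.mul_apply, ← map_mul, ← map_mul,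
    Algebra.TensorProduct.tmul_mul_tmul, Algebra.TensorProduct.tmul_mul_tmul, one_mul, mul_one,
    mul_one, one_mul]

/-- Going once round the square $S^{00}\to S^{10}\to S^{11}\to S^{01}\to S^{00}$ by injective maps
forces all dimensions to agree. -/
theorem finrank_eq [Nontrivial V10] [Nontrivial V01]
    (M : BigradedCliffordModule V10 V01 S00 S10 S01 S11) :
    Module.finrank ℝ S10 = Module.finrank ℝ S00 ∧ Module.finrank ℝ S01 = Module.finrank ℝ S00 ∧
      Module.finrank ℝ S11 = Module.finrank ℝ S00 := by
  have h1 := IsometricMul.finrank_le (m := M.mulLeft0) M.norm_mulLeft0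
  have h2 := IsometricMul.finrank_le (m := M.mulRight1) M.norm_mulRight1
  have h3 : Module.finrank ℝ S11 ≤ Module.finrank ℝ S01 := by
    obtain ⟨w, hw⟩ := exists_ne (0 : V10)
    refine LinearMap.finrank_le_finrank_of_odd
      (A := M.act (CliffordAlgebra.ι (negSq V10) w ⊗ₜ 1))
      (i := LinearMap.inr ℝ (S00 × S10) (S01 × S11) ∘ₗ LinearMap.inr ℝ S01 S11)
      (j := LinearMap.inr ℝ (S00 × S10) (S01 × S11) ∘ₗ LinearMap.inl ℝ S01 S11)
      (c := -(‖w‖ * ‖w‖)) (by simpa using hw) (M.left_sq w) ?_ ?_ (M.left11 w)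
    · exact LinearMap.inr_injective.comp LinearMap.inr_injective
    · exact LinearMap.inr_injective.comp LinearMap.inl_injective
  have h4 : Module.finrank ℝ S01 ≤ Module.finrank ℝ S00 := by
    obtain ⟨w, hw⟩ := exists_ne (0 : V01)
    refine LinearMap.finrank_le_finrank_of_odd
      (A := M.act (1 ⊗ₜ CliffordAlgebra.ι (negSq V01) w))
      (i := LinearMap.inr ℝ (S00 × S10) (S01 × S11) ∘ₗ LinearMap.inl ℝ S01 S11)
      (j := LinearMap.inl ℝ (S00 × S10) (S01 × S11) ∘ₗ LinearMap.inl ℝ S00 S10)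
      (c := -(‖w‖ * ‖w‖)) (by simpa using hw) (M.right_sq w) ?_ ?_ (M.right01 w)
    · exact LinearMap.inr_injective.comp LinearMap.inl_injective
    · exact LinearMap.inl_injective.comp LinearMap.inl_injective
  omega

end BigradedCliffordModule

/-! ### Isomorphisms, duals and homogeneous elements -/

namespace QuasiNil

section General

variable {n : ℕ}

theorem isometricMul (N : QuasiNil.{u} n) {i j k : Fin n} (hij : i < j) (hjk : j < k) :
    IsometricMul (N.mul i j k) := N.isometric i j k hij hjk

theorem mul_eq_zero_of_not_lt_left (N : QuasiNil.{u} n) {i j k : Fin n} (h : ¬ i < j)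
    (x : N.comp i j) (y : N.comp j k) : N.mul i j k x y = 0 := by
  have := N.comp_zero i j h
  rw [Subsingleton.elim x 0, map_zero, LinearMap.zero_apply]

theorem mul_eq_zero_of_not_lt_right (N : QuasiNil.{u} n) {i j k : Fin n} (h : ¬ j < k)
    (x : N.comp i j) (y : N.comp j k) : N.mul i j k x y = 0 := by
  have := N.comp_zero j k h
  rw [Subsingleton.elim y 0, map_zero]

/-- The dimension of a component. -/
abbrev dim (N : QuasiNil.{u} n) (i j : Fin n) : ℕ := Module.finrank ℝ (N.comp i j)

theorem Isomorphic.symm {N : QuasiNil.{u} n} {N' : QuasiNil.{v} n} (h : N.Isomorphic N') :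
    N'.Isomorphic N := by
  obtain ⟨φ, hφ⟩ := h
  refine ⟨fun i j => (φ i j).symm, fun i j k x y => ?_⟩
  rw [LinearIsometryEquiv.symm_apply_eq, hφ, LinearIsometryEquiv.apply_symm_apply,
    LinearIsometryEquiv.apply_symm_apply]

theorem Isomorphic.trans {N : QuasiNil.{u} n} {N' : QuasiNil.{v} n} {N'' : QuasiNil.{w} n}
    (h : N.Isomorphic N') (h' : N'.Isomorphic N'') : N.Isomorphic N'' := by
  obtain ⟨φ, hφ⟩ := h
  obtain ⟨ψ, hψ⟩ := h'
  exact ⟨fun i j => (φ i j).trans (ψ i j), fun i j k x y => by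
    simp only [LinearIsometryEquiv.trans_apply, hφ, hψ]⟩

theorem Isomorphic.dual {N : QuasiNil.{u} n} {N' : QuasiNil.{v} n} (h : N.Isomorphic N') :
    N.dual.Isomorphic N'.dual := by
  obtain ⟨φ, hφ⟩ := h
  exact ⟨fun i j => φ j.rev i.rev, fun i j k x y => hφ _ _ _ y x⟩

theorem Isomorphic.equivalent {N : QuasiNil.{u} n} {N' : QuasiNil.{v} n} (h : N.Isomorphic N') :
    N.Equivalent N' := by
  obtain ⟨φ, hφ⟩ := h
  exact ⟨Equiv.refl _, φ, hφ⟩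

theorem Isomorphic.dim_eq {N : QuasiNil.{u} n} {N' : QuasiNil.{v} n} (h : N.Isomorphic N')
    (i j : Fin n) : N.dim i j = N'.dim i j := by
  obtain ⟨φ, -⟩ := h
  exact (φ i j).toLinearEquiv.finrank_eq

/-- A model in the lowest universe. -/
theorem exists_isomorphic_univ_zero (N : QuasiNil.{u} n) :
    ∃ N' : QuasiNil.{0} n, N.Isomorphic N' := by
  let φ : ∀ i j, N.comp i j ≃ₗᵢ[ℝ] EuclideanSpace ℝ (Fin (N.dim i j)) := fun i j =>
    (stdOrthonormalBasis ℝ (N.comp i j)).repr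
  let m : ∀ i j k, EuclideanSpace ℝ (Fin (N.dim i j)) →ₗ[ℝ] EuclideanSpace ℝ (Fin (N.dim j k)) →ₗ[ℝ]
      EuclideanSpace ℝ (Fin (N.dim i k)) := fun i j k =>
    ((N.mul i j k).compl₁₂ (φ i j).symm.toLinearEquiv.toLinearMap
      (φ j k).symm.toLinearEquiv.toLinearMap).compr₂ (φ i k).toLinearEquiv.toLinearMap
  have hm : ∀ i j k x y, m i j k x y = φ i k (N.mul i j k ((φ i j).symm x) ((φ j k).symm y)) :=
    fun _ _ _ _ _ => rfl
  refine ⟨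
    { comp := fun i j => ⟨EuclideanSpace ℝ (Fin (N.dim i j))⟩
      comp_zero := fun i j h => by
        have := N.comp_zero i j h
        exact (φ i j).symm.injective.subsingleton
      mul := m
      isometric := fun i j k hij hjk x y => by
        change ‖m i j k x y‖ = _
        rw [hm, LinearIsometryEquiv.norm_map, N.isometric i j k hij hjk,
          LinearIsometryEquiv.norm_map, LinearIsometryEquiv.norm_map] }, φ, fun i j k x y => ?_⟩
  change _ = m i j k (φ i j x) (φ j k y)
  rw [hm, LinearIsometryEquiv.symm_apply_apply, LinearIsometryEquiv.symm_apply_apply]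

@[simp]
theorem single_apply_same (N : QuasiNil.{u} n) (i j : Fin n) (x : N.comp i j) :
    N.single i j x i j = x := by
  simp [single]

theorem single_apply_of_ne_left (N : QuasiNil.{u} n) {i j i' : Fin n} (j' : Fin n) (x : N.comp i j)
    (h : i' ≠ i) : N.single i j x i' j' = 0 := by
  simp [single, h]

theorem single_apply_of_ne_right (N : QuasiNil.{u} n) {i j j' : Fin n} (x : N.comp i j)
    (h : j' ≠ j) : N.single i j x i j' = 0 := by
  simp [single, h]

theorem single_matMul_apply (N : QuasiNil.{u} n) {i j : Fin n} (x : N.comp i j) (B : N.Mat)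
    (k : Fin n) : N.matMul (N.single i j x) B i k = N.mul i j k x (B j k) := by
  rw [matMul, Finset.sum_eq_single j, single_apply_same]
  · intro j' _ h
    rw [single_apply_of_ne_right N x h, map_zero, LinearMap.zero_apply]
  · simp

theorem matMul_single_apply (N : QuasiNil.{u} n) {j k : Fin n} (A : N.Mat) (y : N.comp j k)
    (i : Fin n) : N.matMul A (N.single j k y) i k = N.mul i j k (A i j) y := by
  rw [matMul, Finset.sum_eq_single j, single_apply_same]
  · intro j' _ h
    rw [single_apply_of_ne_left N k y h, map_zero]
  · simp

theorem matMul_single_apply_of_ne (N : QuasiNil.{u} n) {j k l : Fin n} (A : N.Mat) (y : N.comp j k)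
    (i : Fin n) (h : l ≠ k) : N.matMul A (N.single j k y) i l = 0 := by
  refine Finset.sum_eq_zero fun j' _ => ?_
  by_cases hj : j' = j
  · subst hj
    rw [single_apply_of_ne_right N y h, map_zero]
  · rw [single_apply_of_ne_left N l y hj, map_zero]

/-- Associativity on homogeneous elements. -/
theorem isAssociative_iff (N : QuasiNil.{u} n) :
    N.IsAssociative ↔ ∀ i j k l (x : N.comp i j) (y : N.comp j k) (z : N.comp k l),
      N.mul i k l (N.mul i j k x y) z = N.mul i j l x (N.mul j k l y z) := by
  constructor
  · intro h i j k l x y z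
    have h1 := congrFun (congrFun (h (N.single i j x) (N.single j k y) (N.single k l z)) i) l
    rwa [matMul_single_apply, single_matMul_apply, single_matMul_apply, matMul_single_apply,
      single_apply_same] at h1
  · intro h A B C
    funext i l
    simp only [matMul, map_sum, LinearMap.sum_apply, h]
    exact Finset.sum_comm

theorem Isomorphic.isAssociative {N : QuasiNil.{u} n} {N' : QuasiNil.{v} n} (h : N.Isomorphic N')
    (hN : N.IsAssociative) : N'.IsAssociative := by
  obtain ⟨φ, hφ⟩ := h.symm
  rw [isAssociative_iff] at hN ⊢
  intro i j k l x y z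
  apply (φ i l).injective
  rw [hφ, hφ, hφ, hφ, hN]

theorem IsAssociative.dual {N : QuasiNil.{u} n} (hN : N.IsAssociative) : N.dual.IsAssociative := by
  rw [isAssociative_iff] at hN ⊢
  intro i j k l x y z
  exact (hN _ _ _ _ z y x).symm

end General

end QuasiNil

/-! ### Full algebras, and the conditions on homogeneous elements in rank 4 -/

namespace QuasiNil

section General

variable {n : ℕ}

theorem matInner_single (N : QuasiNil.{u} n) {i k : Fin n} (a : N.comp i k) (B : N.Mat) :
    N.matInner (N.single i k a) B = ⟪a, B i k⟫_ℝ := by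
  rw [matInner, Finset.sum_eq_single i, Finset.sum_eq_single k, single_apply_same]
  · intro k' _ h
    rw [single_apply_of_ne_right N a h, inner_zero_left]
  · simp
  · intro i' _ h
    exact Finset.sum_eq_zero fun k' _ => by rw [single_apply_of_ne_left N k' a h, inner_zero_left]
  · simp

theorem matInner_matMul_single (N : QuasiNil.{u} n) {i j k : Fin n} (a : N.comp i k)
    (b : N.comp j k) (X Y : N.Mat) :
    N.matInner (N.matMul X (N.single i k a)) (N.matMul Y (N.single j k b)) =
      ∑ l, ⟪N.mul l i k (X l i) a, N.mul l j k (Y l j) b⟫_ℝ := by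
  refine Finset.sum_congr rfl fun l _ => ?_
  rw [Finset.sum_eq_single k, matMul_single_apply, matMul_single_apply]
  · intro k' _ h
    rw [matMul_single_apply_of_ne N X a l h, inner_zero_left]
  · simp

/-- All components above the diagonal are non-zero. -/
def IsFull (N : QuasiNil.{u} n) : Prop := ∀ i j, i < j → Nontrivial (N.comp i j)

theorem IsFull.of_isomorphic {N : QuasiNil.{u} n} {N' : QuasiNil.{v} n} (hN : N.IsFull)
    (h : N.Isomorphic N') : N'.IsFull := by
  obtain ⟨φ, -⟩ := h
  intro i j hij
  have := hN i j hij
  exact (φ i j).symm.surjective.nontrivial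

theorem IsFull.dual {N : QuasiNil.{u} n} (hN : N.IsFull) : N.dual.IsFull :=
  fun i j hij => hN j.rev i.rev (by simpa using hij)

/-- The Clifford condition only concerns dimensions. -/
theorem IsFull.isClifford_iff {N : QuasiNil.{u} n} (hN : N.IsFull) :
    N.IsClifford ↔ ∀ i j k, i < j → j < k → N.dim j k = N.dim i k ∨ N.dim i j = N.dim i k := by
  constructor
  · intro h i j k hij hjk
    have h1 := hN i j hij
    have h2 := hN j k hjk
    have h3 : N.mul i j k ≠ 0 := by
      obtain ⟨x, hx⟩ := exists_ne (0 : N.comp i j)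
      obtain ⟨y, hy⟩ := exists_ne (0 : N.comp j k)
      intro h0
      refine hx ((N.isometricMul hij hjk).eq_zero_of_apply hy ?_)
      rw [h0]
      rfl
    rcases h i j k h3 with ⟨M, -⟩ | ⟨M, -⟩
    · exact .inl M.finrank_eq
    · exact .inr M.finrank_eq
  · intro h i j k h0
    have hij : i < j := by
      by_contra hij
      exact h0 (LinearMap.ext fun x => LinearMap.ext fun y =>
        N.mul_eq_zero_of_not_lt_left hij x y)
    have hjk : j < k := by
      by_contra hjk
      exact h0 (LinearMap.ext fun x => LinearMap.ext fun y =>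
        N.mul_eq_zero_of_not_lt_right hjk x y)
    rcases h i j k hij hjk with h | h
    · obtain ⟨M, hM⟩ := GradedCliffordModule.exists_mulZero_eq (N.isometricMul hij hjk) h
      exact .inl ⟨M, fun x y => by rw [hM]⟩
    · obtain ⟨M, hM⟩ := GradedCliffordModule.exists_mulZero_eq (N.isometricMul hij hjk).flip h
      exact .inr ⟨M, fun x y => by rw [hM, LinearMap.flip_apply]⟩

theorem IsFull.isClifford_of_isomorphic {N : QuasiNil.{u} n} {N' : QuasiNil.{v} n} (hN : N.IsFull)
    (h : N.Isomorphic N') (hC : N.IsClifford) : N'.IsClifford := by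
  rw [(hN.of_isomorphic h).isClifford_iff]
  rw [hN.isClifford_iff] at hC
  intro i j k hij hjk
  rw [← h.dim_eq, ← h.dim_eq, ← h.dim_eq]
  exact hC i j k hij hjk

theorem IsFull.isClifford_dual {N : QuasiNil.{u} n} (hN : N.IsFull) (hC : N.IsClifford) :
    N.dual.IsClifford := by
  rw [hN.dual.isClifford_iff]
  rw [hN.isClifford_iff] at hC
  intro i j k hij hjk
  exact (hC k.rev j.rev i.rev (by simpa using hjk) (by simpa using hij)).symm

end General

section RankFour

theorem _root_.Fin.eq_id_of_lt_four {f : Fin 4 → Fin 4} (h01 : f 0 < f 1) (h12 : f 1 < f 2)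
    (h23 : f 2 < f 3) : f = id := by
  funext i
  have h3 := (f 3).isLt
  rw [Fin.lt_def] at h01 h12 h23
  fin_cases i <;> refine Fin.ext ?_ <;> simp <;> omega

variable {N : QuasiNil.{u} 4}

/-- Edges increase the index, so a path of length 3 visits $0,1,2,3$ in order. The remaining
components contain products of non-zero elements. -/
theorem isFull_of_nilpotencyIndex (h : N.nilpotencyIndex = 3) : N.IsFull := by
  have hmem : 3 ∈ {m | ∃ p : Fin (m + 1) → Fin 4, ∀ t : Fin m, N.Adj (p t.castSucc) (p t.succ)} := by
    rw [nilpotencyIndex] at h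
    rw [← h]
    -- The supremum of an empty or unbounded set of naturals is 0 by convention, so the value 3
    -- guarantees that the maximum is attained.
    refine Nat.sSup_mem ?_ ?_
    · by_contra h0
      rw [Set.not_nonempty_iff_eq_empty.1 h0] at h
      simp at h
    · by_contra h0
      rw [Nat.sSup_of_not_bddAbove h0] at h
      omega
  obtain ⟨p, hp⟩ := hmem
  have hlt : ∀ i j, N.Adj i j → i < j := fun i j hij => by
    by_contra h0
    exact not_subsingleton_iff_nontrivial.2 hij (N.comp_zero i j h0)
  have hid := Fin.eq_id_of_lt_four (hlt _ _ (hp 0)) (hlt _ _ (hp 1)) (hlt _ _ (hp 2))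
  subst hid
  have h01 : Nontrivial (N.comp 0 1) := hp 0
  have h12 : Nontrivial (N.comp 1 2) := hp 1
  have h23 : Nontrivial (N.comp 2 3) := hp 2
  have h02 := (N.isometricMul (i := 0) (j := 1) (k := 2) (by decide) (by decide)).nontrivial
  have h13 := (N.isometricMul (i := 1) (j := 2) (k := 3) (by decide) (by decide)).nontrivial
  have h03 := (N.isometricMul (i := 0) (j := 1) (k := 3) (by decide) (by decide)).nontrivial
  intro i j hij
  fin_cases i <;> fin_cases j <;> first | exact absurd hij (by decide) | assumption

/-- A renumbering must carry non-zero components to positions above the diagonal, so for a full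
algebra it is increasing, hence the identity. -/
theorem IsFull.isomorphic_of_equivalent {N' : QuasiNil.{v} 4} (hN : N.IsFull)
    (h : N.Equivalent N') : N.Isomorphic N' := by
  obtain ⟨σ, φ, hφ⟩ := h
  have hlt : ∀ i j, i < j → σ i < σ j := fun i j hij => by
    by_contra h0
    have := N'.comp_zero _ _ h0
    have := hN i j hij
    exact not_subsingleton (N.comp i j) (φ i j).injective.subsingleton
  have hσ : σ = Equiv.refl _ := Equiv.ext fun i =>
    congrFun (Fin.eq_id_of_lt_four (hlt 0 1 (by decide)) (hlt 1 2 (by decide))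
      (hlt 2 3 (by decide))) i
  subst hσ
  exact ⟨φ, hφ⟩

theorem isAssociative_iff_rank_four : N.IsAssociative ↔
    ∀ (x : N.comp 0 1) (y : N.comp 1 2) (z : N.comp 2 3),
      N.mul 0 2 3 (N.mul 0 1 2 x y) z = N.mul 0 1 3 x (N.mul 1 2 3 y z) := by
  rw [isAssociative_iff]
  refine ⟨fun h => h 0 1 2 3, fun h i j k l x y z => ?_⟩
  by_cases hij : i < j
  · by_cases hjk : j < k
    · by_cases hkl : k < l
      · have hl := l.isLt
        rw [Fin.lt_def] at hij hjk hkl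
        obtain rfl : i = 0 := Fin.ext (by simp; omega)
        obtain rfl : j = 1 := Fin.ext (by simp; omega)
        obtain rfl : k = 2 := Fin.ext (by simp; omega)
        obtain rfl : l = 3 := Fin.ext (by simp; omega)
        exact h x y z
      · rw [mul_eq_zero_of_not_lt_right N hkl, mul_eq_zero_of_not_lt_right N hkl, map_zero]
    · rw [mul_eq_zero_of_not_lt_right N hjk, mul_eq_zero_of_not_lt_left N hjk, map_zero, map_zero,
        LinearMap.zero_apply]
  · rw [mul_eq_zero_of_not_lt_left N hij, mul_eq_zero_of_not_lt_left N hij, map_zero,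
      LinearMap.zero_apply]

/-- A non-zero term in row $l$ of $\langle Na,Nb\rangle$ needs $l<i<j<k$, which in rank 4 leaves
only $0<1<2<3$. -/
theorem vinbergCondition_iff_rank_four : N.VinbergCondition ↔
    ∀ (a : N.comp 1 3) (b : N.comp 2 3), (∀ z, ⟪a, N.mul 1 2 3 z b⟫_ℝ = 0) →
      ∀ x y, ⟪N.mul 0 1 3 x a, N.mul 0 2 3 y b⟫_ℝ = 0 := by
  constructor
  · intro h a b hab x y
    have h1 := h 1 2 3 (by decide) a b (fun X => by
      rw [matInner_single, matMul_single_apply, hab]) (N.single 0 1 x) (N.single 0 2 y)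
    rw [matInner_matMul_single, Finset.sum_eq_single 0, single_apply_same, single_apply_same] at h1
    · exact h1
    · intro l _ hl
      rw [single_apply_of_ne_left N 1 x hl, map_zero, LinearMap.zero_apply, inner_zero_left]
    · simp
  · intro h i j k hij a b hab X Y
    rw [matInner_matMul_single]
    refine Finset.sum_eq_zero fun l _ => ?_
    by_cases hli : l < i
    · by_cases hjk : j < k
      · have hk := k.isLt
        rw [Fin.lt_def] at hij hjk hli
        obtain rfl : l = 0 := Fin.ext (by simp; omega)
        obtain rfl : i = 1 := Fin.ext (by simp; omega)
        obtain rfl : j = 2 := Fin.ext (by simp; omega)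
        obtain rfl : k = 3 := Fin.ext (by simp; omega)
        refine h a b (fun z => ?_) _ _
        have h1 := hab (N.single 1 2 z)
        rwa [matInner_single, matMul_single_apply, single_apply_same] at h1
      · rw [mul_eq_zero_of_not_lt_right N hjk, inner_zero_right]
    · rw [mul_eq_zero_of_not_lt_left N hli, inner_zero_left]

end RankFour

end QuasiNil

/-! ### The Clifford and Vinberg conditions as conditions on dimensions -/

namespace QuasiNil

variable {N : QuasiNil.{u} 4}

theorem IsFull.isClifford_iff_rank_four (hN : N.IsFull) :
    N.IsClifford ↔ (N.dim 1 2 = N.dim 0 2 ∨ N.dim 0 1 = N.dim 0 2) ∧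
      (N.dim 1 3 = N.dim 0 3 ∨ N.dim 0 1 = N.dim 0 3) ∧
      (N.dim 2 3 = N.dim 0 3 ∨ N.dim 0 2 = N.dim 0 3) ∧
      (N.dim 2 3 = N.dim 1 3 ∨ N.dim 1 2 = N.dim 1 3) := by
  rw [hN.isClifford_iff]
  constructor
  · intro h
    exact ⟨h 0 1 2 (by decide) (by decide), h 0 1 3 (by decide) (by decide),
      h 0 2 3 (by decide) (by decide), h 1 2 3 (by decide) (by decide)⟩
  · rintro ⟨h1, h2, h3, h4⟩ i j k hij hjk
    fin_cases i <;> fin_cases j <;> first | exact absurd hij (by decide) | skip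
    all_goals fin_cases k <;> first | exact absurd hjk (by decide) | assumption

theorem IsFull.dim_le_left (hN : N.IsFull) {i j k : Fin 4} (hij : i < j) (hjk : j < k) :
    N.dim i j ≤ N.dim i k := by
  have := hN j k hjk
  exact (N.isometricMul hij hjk).flip.finrank_le

theorem IsFull.dim_le_right (hN : N.IsFull) {i j k : Fin 4} (hij : i < j) (hjk : j < k) :
    N.dim j k ≤ N.dim i k := by
  have := hN i j hij
  exact (N.isometricMul hij hjk).finrank_le

theorem IsFull.dim_pos (hN : N.IsFull) {i j : Fin 4} (hij : i < j) : 0 < N.dim i j := by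
  have := hN i j hij
  exact Module.finrank_pos

theorem IsAssociative.mul_mul (hA : N.IsAssociative) (x : N.comp 0 1) (y : N.comp 1 2)
    (z : N.comp 2 3) : N.mul 0 2 3 (N.mul 0 1 2 x y) z = N.mul 0 1 3 x (N.mul 1 2 3 y z) :=
  isAssociative_iff_rank_four.1 hA x y z

/-- If $d_{12}=d_{02}$ and $x\ne0$, then $y=xz$ for some $z$, and $\langle xa,yb\rangle=\langle
xa,x(zb)\rangle=\|x\|^2\langle a,zb\rangle=0$. If $d_{12}=d_{13}$ and $b\ne0$, then $N_{12}b$ is all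
of $N_{13}$, so $a=0$. -/
theorem IsAssociative.vinbergCondition_of_dim_eq (hA : N.IsAssociative)
    (h : N.dim 1 2 = N.dim 0 2 ∨ N.dim 1 2 = N.dim 1 3) : N.VinbergCondition := by
  rw [vinbergCondition_iff_rank_four]
  intro a b hab x y
  rcases h with h | h
  · by_cases hx : x = 0
    · rw [hx, map_zero, LinearMap.zero_apply, inner_zero_left]
    obtain ⟨z, rfl⟩ :=
      (N.isometricMul (i := 0) (j := 1) (k := 2) (by decide) (by decide)).surjective_left h hx y
    rw [hA.mul_mul, (N.isometricMul (i := 0) (j := 1) (k := 3) (by decide) (by decide)).inner_left,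
      hab, mul_zero]
  · by_cases hb : b = 0
    · rw [hb, map_zero, inner_zero_right]
    obtain ⟨z, rfl⟩ := (N.isometricMul (i := 1) (j := 2) (k := 3) (by decide)
      (by decide)).flip.surjective_left h hb a
    have h1 := hab z
    rw [LinearMap.flip_apply, inner_self_eq_zero] at h1
    rw [LinearMap.flip_apply, h1, map_zero, inner_zero_left]

/-- Let $R=N_{12}b$ and let $x\in N_{01}$ be a unit vector. If multiplication by $x$ maps $N_{13}$
onto $N_{03}$, the Vinberg condition puts the preimage of $N_{02}b$ inside $R^{\perp\perp}=R$, so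
$d_{02}\le d_{12}$. Otherwise $N_{02}b=N_{03}$; if $R\ne N_{13}$, a unit $a\perp R$ gives $xa=yb$
for some $y$, and the condition makes $xa$ orthogonal to itself. -/
theorem IsFull.dim_eq_of_vinbergCondition (hN : N.IsFull) (hC : N.IsClifford)
    (hV : N.VinbergCondition) : N.dim 1 2 = N.dim 0 2 ∨ N.dim 1 2 = N.dim 1 3 := by
  rw [vinbergCondition_iff_rank_four] at hV
  by_contra! hne
  obtain ⟨h1, h2, h3, h4⟩ := hN.isClifford_iff_rank_four.1 hC
  have := hN 0 1 (by decide)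
  have := hN 2 3 (by decide)
  obtain ⟨x, hx⟩ := exists_norm_one (N.comp 0 1)
  obtain ⟨b, hb⟩ := exists_ne (0 : N.comp 2 3)
  have m013 := N.isometricMul (i := 0) (j := 1) (k := 3) (by decide) (by decide)
  have m023 := N.isometricMul (i := 0) (j := 2) (k := 3) (by decide) (by decide)
  have m123 := N.isometricMul (i := 1) (j := 2) (k := 3) (by decide) (by decide)
  set R := LinearMap.range ((N.mul 1 2 3).flip b) with hR
  have hRdim : Module.finrank ℝ R = N.dim 1 2 :=
    LinearMap.finrank_range_of_inj (m123.flip.injective_left hb)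
  by_cases he : N.dim 1 3 = N.dim 0 3
  · let U := m013.leftEquiv he hx
    let g := U.symm.toLinearEquiv.toLinearMap ∘ₗ (N.mul 0 2 3).flip b
    have hUg : ∀ y, N.mul 0 1 3 x (g y) = N.mul 0 2 3 y b := fun y => U.apply_symm_apply _
    have hg : Module.finrank ℝ (LinearMap.range g) = N.dim 0 2 :=
      LinearMap.finrank_range_of_inj (U.symm.injective.comp (m023.flip.injective_left hb))
    have hle : LinearMap.range g ≤ R := by
      rintro _ ⟨y, rfl⟩
      rw [← Submodule.orthogonal_orthogonal R, Submodule.mem_orthogonal]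
      intro a ha
      have h5 := hV a b (fun z => by
        rw [real_inner_comm]
        exact (Submodule.mem_orthogonal _ _).1 ha _ ⟨z, rfl⟩) x y
      rwa [← hUg, m013.inner_left, hx, one_pow, one_mul] at h5
    have h6 := Submodule.finrank_mono hle
    rw [hg, hRdim] at h6
    have h7 := hN.dim_le_right (i := 0) (j := 1) (k := 2) (by decide) (by decide)
    omega
  · have hd : N.dim 0 2 = N.dim 0 3 := by
      have h7 := hN.dim_le_left (i := 0) (j := 1) (k := 2) (by decide) (by decide)
      have h8 := hN.dim_le_left (i := 0) (j := 2) (k := 3) (by decide) (by decide)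
      omega
    have hRtop : R ≠ ⊤ := fun h => by
      rw [h, finrank_top] at hRdim
      exact hne.2 hRdim.symm
    obtain ⟨a, ha, horth⟩ := Submodule.exists_norm_one_orthogonal hRtop
    obtain ⟨y, hy⟩ := m023.flip.surjective_left hd hb (N.mul 0 1 3 x a)
    have h5 := hV a b (fun z => by
      rw [real_inner_comm]
      exact horth _ ⟨z, rfl⟩) x y
    rw [LinearMap.flip_apply] at hy
    rw [hy, inner_self_eq_zero, ← norm_eq_zero, m013, hx, ha] at h5
    norm_num at h5

theorem IsFull.isNil_and_isClifford_iff (hN : N.IsFull) : N.IsNil ∧ N.IsClifford ↔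
    (N.IsAssociative ∧ N.IsClifford) ∧ (N.dim 1 2 = N.dim 0 2 ∨ N.dim 1 2 = N.dim 1 3) := by
  constructor
  · rintro ⟨⟨hA, hV⟩, hC⟩
    exact ⟨⟨hA, hC⟩, hN.dim_eq_of_vinbergCondition hC hV⟩
  · rintro ⟨⟨hA, hC⟩, h⟩
    exact ⟨⟨hA, hA.vinbergCondition_of_dim_eq h⟩, hC⟩

/-! ### Properties of the six model families -/

section Forms

theorem dim_lineSp : Module.finrank ℝ lineSp = 1 := Module.finrank_self ℝ

theorem dim_quatSp : Module.finrank ℝ quatSp = 4 := Quaternion.finrank_eq_four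

section

variable {V10 V01 S00 S10 S01 S11 : EuclSp.{0}}
  (M : BigradedCliffordModule V10 V01 S00 S10 S01 S11)

theorem isAssociative_algN0 : (algN0 M).IsAssociative :=
  isAssociative_iff_rank_four.2 fun x y z => (M.mulLeft1_mulRight0 x z y).symm

theorem dim_algN0 (h : (algN0 M).IsFull) :
    (algN0 M).dim 0 2 = (algN0 M).dim 1 2 ∧ (algN0 M).dim 1 3 = (algN0 M).dim 1 2 ∧
      (algN0 M).dim 0 3 = (algN0 M).dim 1 2 := by
  have : Nontrivial V10 := h 0 1 (by decide)
  have : Nontrivial V01 := h 2 3 (by decide)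
  exact M.finrank_eq

theorem isClifford_algN0 (h : (algN0 M).IsFull) : (algN0 M).IsClifford := by
  rw [h.isClifford_iff_rank_four]
  have := dim_algN0 M h
  omega

end

section

variable {V S0 S1 : EuclSp.{0}} (M : GradedCliffordModule V S0 S1)

theorem isAssociative_algN1 : (algN1 M).IsAssociative :=
  isAssociative_iff_rank_four.2 fun (x : ℝ) (y : V) (z : S0) => by
    change M.mulZero (x • y) z = x • M.mulZero y z
    rw [map_smul, LinearMap.smul_apply]

theorem isClifford_algN1 (h : (algN1 M).IsFull) : (algN1 M).IsClifford := by
  have : Nontrivial V := h 0 2 (by decide)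
  exact h.isClifford_iff_rank_four.2 ⟨.inl rfl, .inl rfl, .inl M.finrank_eq, .inl M.finrank_eq⟩

theorem isAssociative_algN2 : (algN2 M).IsAssociative :=
  isAssociative_iff_rank_four.2 fun (x : V) (y : ℝ) (z : S1) => by
    change M.mulOne (y • x) z = M.mulOne x (y • z)
    rw [map_smul, LinearMap.smul_apply, map_smul]

theorem dim_algN2 (h : (algN2 M).IsFull) : (algN2 M).dim 1 2 = 1 ∧
    (algN2 M).dim 0 2 = Module.finrank ℝ V ∧ (algN2 M).dim 1 3 = (algN2 M).dim 0 3 := by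
  have : Nontrivial V := h 0 2 (by decide)
  exact ⟨dim_lineSp, rfl, M.finrank_eq.symm⟩

theorem isClifford_algN2 (h : (algN2 M).IsFull) : (algN2 M).IsClifford := by
  have : Nontrivial V := h 0 2 (by decide)
  exact h.isClifford_iff_rank_four.2
    ⟨.inr rfl, .inl M.finrank_eq.symm, .inl M.finrank_eq.symm, .inl rfl⟩

end

theorem isAssociative_algN3 (n : ℕ) : (algN3 n).IsAssociative :=
  isAssociative_iff_rank_four.2 fun (x y : ℂ) (z : PiLp 2 fun _ : Fin n => ℂ) =>
    PiLp.ext fun t => mul_assoc x y (z t)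

theorem isClifford_algN3 {n : ℕ} (h : (algN3 n).IsFull) : (algN3 n).IsClifford :=
  h.isClifford_iff_rank_four.2 ⟨.inl rfl, .inl rfl, .inl rfl, .inl rfl⟩

theorem isAssociative_algN4 (W : Submodule ℝ ℍ[ℝ]) (n : ℕ) : (algN4 W n).IsAssociative :=
  isAssociative_iff_rank_four.2 fun (x : W) (y : ℍ[ℝ]) (z : PiLp 2 fun _ : Fin n => ℍ[ℝ]) =>
    PiLp.ext fun t => mul_assoc (x : ℍ[ℝ]) y (z t)

theorem isClifford_algN4 {W : Submodule ℝ ℍ[ℝ]} {n : ℕ} (h : (algN4 W n).IsFull) :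
    (algN4 W n).IsClifford :=
  h.isClifford_iff_rank_four.2 ⟨.inl rfl, .inl rfl, .inl rfl, .inl rfl⟩

theorem isAssociative_algN5 (W : Submodule ℝ ℍ[ℝ]) (n : ℕ) : (algN5 W n).IsAssociative :=
  isAssociative_iff_rank_four.2 fun (x : ℍ[ℝ]) (y : W) (z : PiLp 2 fun _ : Fin n => ℍ[ℝ]) =>
    PiLp.ext fun t => mul_assoc x (y : ℍ[ℝ]) (z t)

theorem isClifford_algN5 {W : Submodule ℝ ℍ[ℝ]} {n : ℕ} (h : (algN5 W n).IsFull) :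
    (algN5 W n).IsClifford :=
  h.isClifford_iff_rank_four.2 ⟨.inr rfl, .inl rfl, .inl rfl, .inl rfl⟩

theorem IsFull.of_isomorphic_form (hN : N.IsFull) {N' : QuasiNil.{v} 4} (h : N.Isomorphic N')
    (hA : N'.IsAssociative) (hC : N'.IsFull → N'.IsClifford) : N.IsAssociative ∧ N.IsClifford :=
  ⟨h.symm.isAssociative hA,
    (hN.of_isomorphic h).isClifford_of_isomorphic h.symm (hC (hN.of_isomorphic h))⟩

theorem IsFull.of_hasAssociativeForm (hN : N.IsFull) (h : N.HasAssociativeForm) :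
    N.IsAssociative ∧ N.IsClifford := by
  rcases h with ⟨_, _, _, _, _, _, M, h⟩ | ⟨_, _, _, M, h⟩ | ⟨_, _, _, M, h⟩ | ⟨n, h⟩ | ⟨W, n, h⟩ |
    ⟨W, n, h⟩
  · exact hN.of_isomorphic_form h (isAssociative_algN0 M) (isClifford_algN0 M)
  · exact hN.of_isomorphic_form h (isAssociative_algN1 M) (isClifford_algN1 M)
  · exact hN.of_isomorphic_form h (isAssociative_algN2 M) (isClifford_algN2 M)
  · exact hN.of_isomorphic_form h (isAssociative_algN3 n) isClifford_algN3
  · exact hN.of_isomorphic_form h (isAssociative_algN4 W n) isClifford_algN4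
  · exact hN.of_isomorphic_form h (isAssociative_algN5 W n) isClifford_algN5

theorem HasNilForm.hasAssociativeForm (h : N.HasNilForm) : N.HasAssociativeForm := by
  rcases h with h | h | h | h
  · exact .inl h
  · exact .inr (.inl h)
  · exact .inr (.inr (.inr (.inl h)))
  · exact .inr (.inr (.inr (.inr (.inl h))))

theorem IsFull.dim_eq_of_hasNilForm (hN : N.IsFull) (h : N.HasNilForm) :
    N.dim 1 2 = N.dim 0 2 := by
  rcases h with ⟨_, _, _, _, _, _, M, h⟩ | ⟨_, _, _, M, h⟩ | ⟨n, h⟩ | ⟨W, n, h⟩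
  · rw [h.dim_eq, h.dim_eq]
    exact (dim_algN0 M (hN.of_isomorphic h)).1.symm
  · rw [h.dim_eq, h.dim_eq]
    rfl
  · rw [h.dim_eq, h.dim_eq]
    rfl
  · rw [h.dim_eq, h.dim_eq]
    rfl

/-- In both families $d_{12}<d_{02}\le d_{03}=d_{13}$, so both alternatives of the dimension form of
the Vinberg condition fail. -/
theorem IsFull.dim_ne_of_isExceptional (hN : N.IsFull) (h : N.IsExceptional) :
    N.dim 1 2 ≠ N.dim 0 2 ∧ N.dim 1 2 ≠ N.dim 1 3 := by
  have h02 := hN.dim_le_left (i := 0) (j := 2) (k := 3) (by decide) (by decide)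
  rcases h with ⟨V, _, _, M, hV, h⟩ | ⟨W, n, hW, h⟩
  · have h := hN.isomorphic_of_equivalent h
    have hd := dim_algN2 M (hN.of_isomorphic h)
    simp only [← h.dim_eq] at hd
    omega
  · have h := hN.isomorphic_of_equivalent h
    have h1 : N.dim 1 2 = Module.finrank ℝ W := h.dim_eq 1 2
    have h2 : N.dim 0 2 = 4 := (h.dim_eq 0 2).trans dim_quatSp
    have h3 : N.dim 1 3 = N.dim 0 3 := (h.dim_eq 1 3).trans (h.dim_eq 0 3).symm
    omega

/-- Only $N_{(2)}$ and $N_{(5)}$ allow $d_{12}\ne d_{02}$, and there the inequality excludes $\dim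
V=1$ and $W=\mathbb H$. -/
theorem IsFull.isExceptional_of_hasAssociativeForm (hN : N.IsFull) (h : N.HasAssociativeForm)
    (hne : N.dim 1 2 ≠ N.dim 0 2) : N.IsExceptional := by
  rcases h with h | h | ⟨V, _, _, M, h⟩ | h | h | ⟨W, n, h⟩
  · exact absurd (hN.dim_eq_of_hasNilForm (.inl h)) hne
  · exact absurd (hN.dim_eq_of_hasNilForm (.inr (.inl h))) hne
  · refine .inl ⟨V, _, _, M, ?_, h.equivalent⟩
    have hd := dim_algN2 M (hN.of_isomorphic h)
    simp only [← h.dim_eq] at hd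
    have := hN.dim_pos (i := 0) (j := 2) (by decide)
    omega
  · exact absurd (hN.dim_eq_of_hasNilForm (.inr (.inr (.inl h)))) hne
  · exact absurd (hN.dim_eq_of_hasNilForm (.inr (.inr (.inr h)))) hne
  · refine .inr ⟨W, n, ?_, h.equivalent⟩
    have h1 : N.dim 1 2 = Module.finrank ℝ W := h.dim_eq 1 2
    have h2 : N.dim 0 2 = 4 := (h.dim_eq 0 2).trans dim_quatSp
    have := hN.dim_le_right (i := 0) (j := 1) (k := 2) (by decide) (by decide)
    omega

end Forms

end QuasiNil

/-! ### Recognition of the bigraded and graded module families -/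

namespace QuasiNil

/-- The isometry between zero spaces. -/
def zeroIsometryEquiv (E F : Type*) [NormedAddCommGroup E] [InnerProductSpace ℝ E]
    [NormedAddCommGroup F] [InnerProductSpace ℝ F] [Subsingleton E] [Subsingleton F] :
    E ≃ₗᵢ[ℝ] F :=
  ⟨LinearEquiv.ofSubsingleton E F, fun x => by
    rw [Subsingleton.elim x 0, map_zero, norm_zero, norm_zero]⟩

section Blocks

variable {N : QuasiNil.{u} 4} {X12 X13 X14 X23 X24 X34 : EuclSp.{0}}

/-- Isometries of the six blocks, extended by zero to all entries. -/
def blockIsometryEquiv (N : QuasiNil.{u} 4) (f12 : N.comp 0 1 ≃ₗᵢ[ℝ] X12)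
    (f13 : N.comp 0 2 ≃ₗᵢ[ℝ] X13)
    (f14 : N.comp 0 3 ≃ₗᵢ[ℝ] X14) (f23 : N.comp 1 2 ≃ₗᵢ[ℝ] X23) (f24 : N.comp 1 3 ≃ₗᵢ[ℝ] X24)
    (f34 : N.comp 2 3 ≃ₗᵢ[ℝ] X34) (i j : Fin 4) :
    N.comp i j ≃ₗᵢ[ℝ] blockComp X12 X13 X14 X23 X24 X34 i j :=
  have : Subsingleton EuclSp.zero := inferInstanceAs (Subsingleton (EuclideanSpace ℝ (Fin 0)))
  have z : ∀ i j : Fin 4, ¬ i < j → N.comp i j ≃ₗᵢ[ℝ] EuclSp.zero := fun i j h =>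
    have := N.comp_zero i j h
    zeroIsometryEquiv _ _
  match i, j with
  | 0, 1 => f12
  | 0, 2 => f13
  | 0, 3 => f14
  | 1, 2 => f23
  | 1, 3 => f24
  | 2, 3 => f34
  | 0, 0 => z 0 0 (by decide)
  | 1, 0 => z 1 0 (by decide)
  | 1, 1 => z 1 1 (by decide)
  | 2, 0 => z 2 0 (by decide)
  | 2, 1 => z 2 1 (by decide)
  | 2, 2 => z 2 2 (by decide)
  | 3, 0 => z 3 0 (by decide)
  | 3, 1 => z 3 1 (by decide)
  | 3, 2 => z 3 2 (by decide)
  | 3, 3 => z 3 3 (by decide)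

theorem isomorphic_ofBlocks
    {m123 : X12 →ₗ[ℝ] X23 →ₗ[ℝ] X13} {m124 : X12 →ₗ[ℝ] X24 →ₗ[ℝ] X14}
    {m134 : X13 →ₗ[ℝ] X34 →ₗ[ℝ] X14} {m234 : X23 →ₗ[ℝ] X34 →ₗ[ℝ] X24}
    {h123 : ∀ x y, ‖m123 x y‖ = ‖x‖ * ‖y‖} {h124 : ∀ x y, ‖m124 x y‖ = ‖x‖ * ‖y‖}
    {h134 : ∀ x y, ‖m134 x y‖ = ‖x‖ * ‖y‖} {h234 : ∀ x y, ‖m234 x y‖ = ‖x‖ * ‖y‖}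
    (f12 : N.comp 0 1 ≃ₗᵢ[ℝ] X12) (f13 : N.comp 0 2 ≃ₗᵢ[ℝ] X13) (f14 : N.comp 0 3 ≃ₗᵢ[ℝ] X14)
    (f23 : N.comp 1 2 ≃ₗᵢ[ℝ] X23) (f24 : N.comp 1 3 ≃ₗᵢ[ℝ] X24) (f34 : N.comp 2 3 ≃ₗᵢ[ℝ] X34)
    (c123 : ∀ x y, f13 (N.mul 0 1 2 x y) = m123 (f12 x) (f23 y))
    (c124 : ∀ x y, f14 (N.mul 0 1 3 x y) = m124 (f12 x) (f24 y))
    (c134 : ∀ x y, f14 (N.mul 0 2 3 x y) = m134 (f13 x) (f34 y))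
    (c234 : ∀ x y, f24 (N.mul 1 2 3 x y) = m234 (f23 x) (f34 y)) :
    N.Isomorphic (ofBlocks m123 m124 m134 m234 h123 h124 h134 h234) := by
  let φ : ∀ i j, N.comp i j ≃ₗᵢ[ℝ]
      (ofBlocks m123 m124 m134 m234 h123 h124 h134 h234).comp i j :=
    blockIsometryEquiv N f12 f13 f14 f23 f24 f34
  refine ⟨φ, fun i j k x y => ?_⟩
  by_cases hij : i < j
  · by_cases hjk : j < k
    · fin_cases i <;> fin_cases j <;> first | exact absurd hij (by decide) | skip
      all_goals fin_cases k <;> first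
        | exact absurd hjk (by decide) | exact c123 x y | exact c124 x y | exact c134 x y
        | exact c234 x y
    · rw [mul_eq_zero_of_not_lt_right _ hjk, mul_eq_zero_of_not_lt_right _ hjk, map_zero]
  · rw [mul_eq_zero_of_not_lt_left _ hij, mul_eq_zero_of_not_lt_left _ hij, map_zero]

end Blocks

section Classification

variable {N : QuasiNil.{0} 4}

theorem IsAssociative.hasForm0 (hA : N.IsAssociative) (h02 : N.dim 1 2 = N.dim 0 2)
    (h13 : N.dim 1 2 = N.dim 1 3) (h03 : N.dim 1 2 = N.dim 0 3) : N.HasForm0 := by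
  obtain ⟨M, h1, h2, h3, h4⟩ := BigradedCliffordModule.exists_of_commute
    (N.isometricMul (i := 0) (j := 1) (k := 2) (by decide) (by decide))
    (N.isometricMul (i := 0) (j := 1) (k := 3) (by decide) (by decide))
    (N.isometricMul (i := 1) (j := 2) (k := 3) (by decide) (by decide)).flip
    (N.isometricMul (i := 0) (j := 2) (k := 3) (by decide) (by decide)).flip h02 h13 h03
    (fun v w s => (hA.mul_mul v s w).symm)
  refine ⟨_, _, _, _, _, _, M, isomorphic_ofBlocks (.refl ℝ _) (.refl ℝ _) (.refl ℝ _) (.refl ℝ _)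
    (.refl ℝ _) (.refl ℝ _) ?_ ?_ ?_ ?_⟩
  · rw [h1]
    exact fun x y => rfl
  · rw [h2]
    exact fun x y => rfl
  · rw [h4]
    exact fun x y => rfl
  · rw [h3]
    exact fun x y => rfl

/-- A one-dimensional space is identified with `ℝ` by a unit vector. -/
theorem exists_isometryEquiv_lineSp {E : Type*} [NormedAddCommGroup E] [InnerProductSpace ℝ E]
    [FiniteDimensional ℝ E] (h : Module.finrank ℝ E = 1) {e : E} (he : ‖e‖ = 1) :
    ∃ f : E ≃ₗᵢ[ℝ] lineSp, ∀ x, x = (show ℝ from f x) • e := by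
  let g : lineSp ≃ₗᵢ[ℝ] E := LinearIsometry.toLinearIsometryEquiv
    ⟨LinearMap.toSpanSingleton ℝ E e, fun x => by
      change ‖(show ℝ from x) • e‖ = _
      rw [norm_smul, he, mul_one]
      rfl⟩ (dim_lineSp.trans h.symm)
  exact ⟨g.symm, fun x => (g.apply_symm_apply x).symm⟩

/-- Multiplication by a unit vector $e\in N_{01}$ identifies $N_{12}$ with $N_{02}$ and $N_{13}$
with $N_{03}$. By $(ey)z=e(yz)$ the two products into the last column become the same Clifford
multiplication. -/
theorem IsAssociative.hasForm1 (hA : N.IsAssociative) (hN : N.IsFull) (h01 : N.dim 0 1 = 1)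
    (h02 : N.dim 1 2 = N.dim 0 2) (h13 : N.dim 1 3 = N.dim 0 3) (h23 : N.dim 2 3 = N.dim 0 3) :
    N.HasForm1 := by
  have := hN 0 1 (by decide)
  obtain ⟨e, he⟩ := exists_norm_one (N.comp 0 1)
  obtain ⟨f, hf⟩ := exists_isometryEquiv_lineSp h01 he
  let P := (N.isometricMul (i := 0) (j := 1) (k := 2) (by decide) (by decide)).leftEquiv h02 he
  let U := (N.isometricMul (i := 0) (j := 1) (k := 3) (by decide) (by decide)).leftEquiv h13 he
  obtain ⟨M, hM⟩ := GradedCliffordModule.exists_mulZero_eq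
    (N.isometricMul (i := 1) (j := 2) (k := 3) (by decide) (by decide)) (h23.trans h13.symm)
  refine ⟨_, _, _, M, isomorphic_ofBlocks f P.symm U.symm (.refl ℝ _) (.refl ℝ _) (.refl ℝ _)
    (fun x y => ?_) (fun x y => ?_) (fun x y => ?_) (fun x y => ?_)⟩
  · rw [LinearIsometryEquiv.symm_apply_eq]
    conv_lhs => rw [hf x, map_smul, LinearMap.smul_apply]
    exact (map_smul P _ y).symm
  · rw [LinearIsometryEquiv.symm_apply_eq]
    conv_lhs => rw [hf x, map_smul, LinearMap.smul_apply]
    exact (map_smul U _ y).symm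
  · rw [hM]
    obtain ⟨x, rfl⟩ := P.surjective x
    rw [LinearIsometryEquiv.symm_apply_eq, LinearIsometryEquiv.symm_apply_apply]
    exact hA.mul_mul e x y
  · rw [hM]
    rfl

/-- Here the unit vector $e$ lies in $N_{12}$: it identifies $N_{01}$ with $N_{02}$ on the right and
$N_{23}$ with $N_{13}$ on the left, and $(xe)z=x(ez)$ identifies the two products into $N_{03}$. -/
theorem IsAssociative.hasForm2 (hA : N.IsAssociative) (hN : N.IsFull) (h12 : N.dim 1 2 = 1)
    (h01 : N.dim 0 1 = N.dim 0 2) (h13 : N.dim 1 3 = N.dim 0 3) (h23 : N.dim 2 3 = N.dim 0 3) :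
    N.HasForm2 := by
  have := hN 1 2 (by decide)
  obtain ⟨e, he⟩ := exists_norm_one (N.comp 1 2)
  obtain ⟨f, hf⟩ := exists_isometryEquiv_lineSp h12 he
  let Q := (N.isometricMul (i := 0) (j := 1) (k := 2) (by decide) (by decide)).flip.leftEquiv h01 he
  let T := (N.isometricMul (i := 1) (j := 2) (k := 3) (by decide) (by decide)).leftEquiv
    (h23.trans h13.symm) he
  obtain ⟨M, hM⟩ := GradedCliffordModule.exists_mulOne_eq
    (N.isometricMul (i := 0) (j := 1) (k := 3) (by decide) (by decide)) h13
  refine ⟨_, _, _, M, isomorphic_ofBlocks (.refl ℝ _) Q.symm (.refl ℝ _) f (.refl ℝ _) T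
    (fun x y => ?_) (fun x y => ?_) (fun x y => ?_) (fun x y => ?_)⟩
  · rw [LinearIsometryEquiv.symm_apply_eq]
    conv_lhs => rw [hf y, map_smul]
    exact (map_smul Q _ x).symm
  · rw [hM]
    rfl
  · rw [hM]
    obtain ⟨x, rfl⟩ := Q.surjective x
    rw [LinearIsometryEquiv.symm_apply_apply]
    exact hA.mul_mul x e y
  · conv_lhs => rw [hf x, map_smul, LinearMap.smul_apply]
    rfl

end Classification

end QuasiNil

/-- A unit vector orthogonal to a given vector in a space of dimension greater than one. -/
theorem exists_norm_one_inner_eq_zero {E : Type*} [NormedAddCommGroup E] [InnerProductSpace ℝ E]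
    [FiniteDimensional ℝ E] (h : 1 < Module.finrank ℝ E) (e : E) :
    ∃ u : E, ‖u‖ = 1 ∧ ⟪u, e⟫_ℝ = 0 := by
  have hW : Submodule.span ℝ {e} ≠ ⊤ := fun hW => by
    have h1 := finrank_span_le_card (R := ℝ) ({e} : Set E)
    rw [hW, finrank_top, Set.toFinset_singleton, Finset.card_singleton] at h1
    omega
  obtain ⟨u, hu, horth⟩ := Submodule.exists_norm_one_orthogonal hW
  exact ⟨u, hu, by rw [real_inner_comm]; exact horth e (Submodule.mem_span_singleton_self e)⟩

/-! ### Complex and quaternionic coordinates -/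

namespace QuasiNil

/-- Coordinates of a rank 4 algebra with entries in a division algebra `K` and, in the last column,
in `K^n`, for which all products are products of `K`. -/
def HasCoordinates (K : Type) [NormedDivisionRing K] [NormedAlgebra ℝ K] (N : QuasiNil.{0} 4) :
    Prop :=
  ∃ (n : ℕ) (f12 : N.comp 0 1 →ₗᵢ[ℝ] K) (f13 : N.comp 0 2 ≃ₗᵢ[ℝ] K) (f23 : N.comp 1 2 →ₗᵢ[ℝ] K)
    (g14 : N.comp 0 3 ≃ₗᵢ[ℝ] PiLp 2 fun _ : Fin n => K)
    (g24 : N.comp 1 3 ≃ₗᵢ[ℝ] PiLp 2 fun _ : Fin n => K)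
    (g34 : N.comp 2 3 ≃ₗᵢ[ℝ] PiLp 2 fun _ : Fin n => K),
    (∀ x y, f13 (N.mul 0 1 2 x y) = f12 x * f23 y) ∧
    (∀ x y, g14 (N.mul 0 1 3 x y) = WithLp.toLp 2 fun t => f12 x * g24 y t) ∧
    (∀ x y, g14 (N.mul 0 2 3 x y) = WithLp.toLp 2 fun t => f13 x * g34 y t) ∧
    (∀ x y, g24 (N.mul 1 2 3 x y) = WithLp.toLp 2 fun t => f23 x * g34 y t)

variable {N : QuasiNil.{0} 4}

/-- If the components of the last column have the same dimension, then the algebra is given by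
similarities of the space `N₃₄`. -/
theorem IsAssociative.exists_action (hA : N.IsAssociative) (h13 : N.dim 1 3 = N.dim 0 3)
    (h23 : N.dim 2 3 = N.dim 0 3) {a : N.comp 0 1} (ha : ‖a‖ = 1) {b : N.comp 1 2}
    (hb : ‖b‖ = 1) :
    ∃ (β : N.comp 0 2 →ₗ[ℝ] Module.End ℝ (N.comp 2 3)) (T : N.comp 2 3 ≃ₗᵢ[ℝ] N.comp 1 3)
      (V : N.comp 2 3 ≃ₗᵢ[ℝ] N.comp 0 3), IsometricMul β ∧ β (N.mul 0 1 2 a b) = 1 ∧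
      (∀ x s, N.mul 0 1 3 x (T s) = V (β (N.mul 0 1 2 x b) s)) ∧
      (∀ d s, N.mul 0 2 3 d s = V (β d s)) ∧
      (∀ y s, N.mul 1 2 3 y s = T (β (N.mul 0 1 2 a y) s)) ∧
      ∀ x y, β (N.mul 0 1 2 x y) = β (N.mul 0 1 2 x b) * β (N.mul 0 1 2 a y) := by
  have m023 := N.isometricMul (i := 0) (j := 2) (k := 3) (by decide) (by decide)
  let T := (N.isometricMul (i := 1) (j := 2) (k := 3) (by decide) (by decide)).leftEquiv
    (h23.trans h13.symm) hb
  let U := (N.isometricMul (i := 0) (j := 1) (k := 3) (by decide) (by decide)).leftEquiv h13 ha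
  -- The map $s\mapsto a(bs)$ identifies $N_{23}$ with $N_{03}$, and `β d` is multiplication by $d$
  -- read through it. Associativity gives $\beta(ab)=1$.
  let β : N.comp 0 2 →ₗ[ℝ] Module.End ℝ (N.comp 2 3) :=
    (N.mul 0 2 3).compr₂ (T.trans U).symm.toLinearEquiv.toLinearMap
  have hT : ∀ s, T s = N.mul 1 2 3 b s := fun s => rfl
  have hU : ∀ s, U s = N.mul 0 1 3 a s := fun s => rfl
  have hV : ∀ s, (T.trans U) s = U (T s) := fun s => rfl
  have h2 : ∀ d s, N.mul 0 2 3 d s = (T.trans U) (β d s) := fun d s =>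
    ((T.trans U).apply_symm_apply _).symm
  have h1 : ∀ x s, N.mul 0 1 3 x (T s) = (T.trans U) (β (N.mul 0 1 2 x b) s) := fun x s => by
    rw [← h2, hA.mul_mul, hT]
  have h3 : ∀ y s, N.mul 1 2 3 y s = T (β (N.mul 0 1 2 a y) s) := fun y s => U.injective (by
    rw [← hV, ← h2, hA.mul_mul, hU])
  refine ⟨β, T, T.trans U, fun d s => ?_, LinearMap.ext fun s => (T.trans U).injective ?_,
    h1, h2, h3, fun x y => LinearMap.ext fun s => (T.trans U).injective ?_⟩
  · rw [← m023, h2, LinearIsometryEquiv.norm_map]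
  · rw [← h2, hA.mul_mul, hV, hU, hT, Module.End.one_apply]
  · rw [Module.End.mul_apply, ← h2, ← h1, ← h3, hA.mul_mul]

variable {K : Type} [NormedDivisionRing K] [NormedAlgebra ℝ K]

/-- In the coordinates of $K$, $x\in N_{01}$ is represented by $xb$ and $y\in N_{12}$ by $ay$. Since
$\beta$ is injective, the multiplicativity in `h4` turns the product $xy$ into a product in $K$. -/
theorem hasCoordinates_of_action [FiniteDimensional ℝ K] [Nontrivial (N.comp 2 3)] {a : N.comp 0 1} (ha : ‖a‖ = 1)
    {b : N.comp 1 2} (hb : ‖b‖ = 1) {β : N.comp 0 2 →ₗ[ℝ] Module.End ℝ (N.comp 2 3)}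
    {T : N.comp 2 3 ≃ₗᵢ[ℝ] N.comp 1 3} {V : N.comp 2 3 ≃ₗᵢ[ℝ] N.comp 0 3} (hβ : IsometricMul β)
    (h1 : ∀ x s, N.mul 0 1 3 x (T s) = V (β (N.mul 0 1 2 x b) s))
    (h2 : ∀ d s, N.mul 0 2 3 d s = V (β d s))
    (h3 : ∀ y s, N.mul 1 2 3 y s = T (β (N.mul 0 1 2 a y) s))
    (h4 : ∀ x y, β (N.mul 0 1 2 x y) = β (N.mul 0 1 2 x b) * β (N.mul 0 1 2 a y))
    (ρ : K →ₐ[ℝ] Module.End ℝ (N.comp 2 3)) (φ : K ≃ₗᵢ[ℝ] N.comp 0 2)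
    (hφ : ∀ k, β (φ k) = ρ k) : N.HasCoordinates K := by
  have m012 := N.isometricMul (i := 0) (j := 1) (k := 2) (by decide) (by decide)
  have hβρ : ∀ d, β d = ρ (φ.symm d) := fun d => by rw [← hφ, φ.apply_symm_apply]
  obtain ⟨n, ψ, hψ⟩ := exists_isometryEquiv_pow ρ fun k s => by
    rw [← hφ, hβ, LinearIsometryEquiv.norm_map]
  refine ⟨n, φ.symm.toLinearIsometry.comp (m012.flip.leftIsometry hb), φ.symm,
    φ.symm.toLinearIsometry.comp (m012.leftIsometry ha), V.symm.trans ψ, T.symm.trans ψ, ψ,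
    fun x y => ?_, fun x y => ?_, fun x y => ?_, fun x y => ?_⟩
  · change φ.symm (N.mul 0 1 2 x y) = φ.symm (N.mul 0 1 2 x b) * φ.symm (N.mul 0 1 2 a y)
    rw [LinearIsometryEquiv.symm_apply_eq]
    apply hβ.injective
    rw [hφ, map_mul, ← hβρ, ← hβρ, h4]
  · obtain ⟨s, rfl⟩ := T.surjective y
    change ψ (V.symm (N.mul 0 1 3 x (T s))) =
      WithLp.toLp 2 fun t => φ.symm (N.mul 0 1 2 x b) * ψ (T.symm (T s)) t
    rw [h1, V.symm_apply_apply, T.symm_apply_apply, hβρ, hψ]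
  · change ψ (V.symm (N.mul 0 2 3 x y)) = _
    rw [h2, V.symm_apply_apply, hβρ, hψ]
  · change ψ (T.symm (N.mul 1 2 3 x y)) =
      WithLp.toLp 2 fun t => φ.symm (N.mul 0 1 2 a x) * ψ y t
    rw [h3, T.symm_apply_apply, hβρ, hψ]

/-- If $d_{12}=d_{02}$, every element of $N_{02}$ is some $ay$, and for a unit $a'\perp a$ the
relation $\beta(a'y)=\beta(a'b)\beta(ay)$ is left stability under $u=a'b\perp ab$. If
$d_{01}=d_{02}$, the mirror argument with $u=ab'$ gives right stability. -/
theorem IsAssociative.hasCoordinates (hA : N.IsAssociative) (hN : N.IsFull)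
    (h13 : N.dim 1 3 = N.dim 0 3) (h23 : N.dim 2 3 = N.dim 0 3)
    (h : (N.dim 1 2 = N.dim 0 2 ∧ 1 < N.dim 0 1) ∨ (N.dim 0 1 = N.dim 0 2 ∧ 1 < N.dim 1 2)) :
    N.HasCoordinates ℂ ∨ N.HasCoordinates ℍ[ℝ] := by
  have := hN 0 1 (by decide)
  have := hN 1 2 (by decide)
  have := hN 2 3 (by decide)
  obtain ⟨a, ha⟩ := exists_norm_one (N.comp 0 1)
  obtain ⟨b, hb⟩ := exists_norm_one (N.comp 1 2)
  have m012 := N.isometricMul (i := 0) (j := 1) (k := 2) (by decide) (by decide)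
  obtain ⟨β, T, V, hβ, he, h1, h2, h3, h4⟩ := hA.exists_action h13 h23 ha hb
  obtain ⟨u, hu, hue, hclosed⟩ : ∃ u, ‖u‖ = 1 ∧ ⟪u, N.mul 0 1 2 a b⟫_ℝ = 0 ∧
      ((∀ x, ∃ y, β y = β u * β x) ∨ ∀ x, ∃ y, β y = β x * β u) := by
    rcases h with ⟨hd, hlt⟩ | ⟨hd, hlt⟩
    · obtain ⟨a', ha', haa⟩ := exists_norm_one_inner_eq_zero hlt a
      refine ⟨N.mul 0 1 2 a' b, by rw [m012, ha', hb, one_mul],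
        by rw [m012.inner_right, haa, zero_mul], .inl fun d => ?_⟩
      obtain ⟨y, rfl⟩ := (m012.leftEquiv hd ha).surjective d
      exact ⟨N.mul 0 1 2 a' y, h4 a' y⟩
    · obtain ⟨b', hb', hbb⟩ := exists_norm_one_inner_eq_zero hlt b
      refine ⟨N.mul 0 1 2 a b', by rw [m012, ha, hb', one_mul],
        by rw [m012.inner_left, hbb, mul_zero], .inr fun d => ?_⟩
      obtain ⟨x, rfl⟩ := (m012.flip.leftEquiv hd hb).surjective d
      exact ⟨N.mul 0 1 2 x b', h4 x b'⟩
  rcases complex_or_quaternion_action hβ he hu hue hclosed with ⟨ρ, φ, hφ⟩ | ⟨ρ, φ, hφ⟩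
  · exact .inl (hasCoordinates_of_action ha hb hβ h1 h2 h3 h4 ρ φ hφ)
  · exact .inr (hasCoordinates_of_action ha hb hβ h1 h2 h3 h4 ρ φ hφ)

theorem HasCoordinates.dim_eq (h : N.HasCoordinates K) : N.dim 0 2 = Module.finrank ℝ K := by
  obtain ⟨n, f12, f13, -⟩ := h
  exact f13.toLinearEquiv.finrank_eq

theorem HasCoordinates.hasForm3 (h : N.HasCoordinates ℂ) (h01 : N.dim 0 1 = N.dim 0 2)
    (h12 : N.dim 1 2 = N.dim 0 2) : N.HasForm3 := by
  have hd := h.dim_eq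
  obtain ⟨n, f12, f13, f23, g14, g24, g34, c1, c2, c3, c4⟩ := h
  exact ⟨n, isomorphic_ofBlocks (X12 := complexSp) (X13 := complexSp) (X14 := complexPowSp n)
    (X23 := complexSp) (X24 := complexPowSp n) (X34 := complexPowSp n)
    (f12.toLinearIsometryEquiv (h01.trans hd)) f13 g14 (f23.toLinearIsometryEquiv (h12.trans hd))
    g24 g34 c1 c2 c3 c4⟩

theorem HasCoordinates.hasForm4 (h : N.HasCoordinates ℍ[ℝ]) (h12 : N.dim 1 2 = N.dim 0 2) :
    N.HasForm4 := by
  have hd := h.dim_eq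
  obtain ⟨n, f12, f13, f23, g14, g24, g34, c1, c2, c3, c4⟩ := h
  exact ⟨LinearMap.range f12.toLinearMap, n, isomorphic_ofBlocks
    (X12 := subSp (LinearMap.range f12.toLinearMap)) (X13 := quatSp) (X14 := quatPowSp n)
    (X23 := quatSp) (X24 := quatPowSp n) (X34 := quatPowSp n)
    f12.equivRange f13 g14 (f23.toLinearIsometryEquiv (h12.trans hd)) g24 g34 c1 c2 c3 c4⟩

theorem HasCoordinates.hasForm5 (h : N.HasCoordinates ℍ[ℝ]) (h01 : N.dim 0 1 = N.dim 0 2) :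
    N.HasForm5 := by
  have hd := h.dim_eq
  obtain ⟨n, f12, f13, f23, g14, g24, g34, c1, c2, c3, c4⟩ := h
  exact ⟨LinearMap.range f23.toLinearMap, n, isomorphic_ofBlocks
    (X12 := quatSp) (X13 := quatSp) (X14 := quatPowSp n)
    (X23 := subSp (LinearMap.range f23.toLinearMap)) (X24 := quatPowSp n) (X34 := quatPowSp n)
    (f12.toLinearIsometryEquiv (h01.trans hd)) f13 g14 f23.equivRange g24 g34 c1 c2 c3 c4⟩

end QuasiNil

/-! ### Case analysis on dimensions -/

namespace QuasiNil

section Classification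

variable {N : QuasiNil.{0} 4}

theorem IsFull.hasNilForm_of_dim_eq (hN : N.IsFull) (hA : N.IsAssociative) (hC : N.IsClifford)
    (h : N.dim 1 2 = N.dim 0 2) : N.HasNilForm := by
  obtain ⟨h1, h2, h3, h4⟩ := hN.isClifford_iff_rank_four.1 hC
  have hle1 := hN.dim_le_left (i := 1) (j := 2) (k := 3) (by decide) (by decide)
  have hle2 := hN.dim_le_right (i := 0) (j := 1) (k := 3) (by decide) (by decide)
  have hle3 := hN.dim_le_right (i := 1) (j := 2) (k := 3) (by decide) (by decide)
  have hle4 := hN.dim_le_left (i := 0) (j := 1) (k := 2) (by decide) (by decide)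
  have hpos := hN.dim_pos (i := 0) (j := 1) (by decide)
  by_cases h03 : N.dim 1 2 = N.dim 0 3
  · exact .inl (hA.hasForm0 h (by omega) h03)
  -- Otherwise $d_{01}=d_{03}$ by the Clifford condition, and $d_{01}\le d_{02}=d_{12}\le d_{03}$
  -- would contradict `h03`. In the next line, $d_{02}=d_{12}\ne d_{03}$ leaves only
  -- $d_{23}=d_{03}$.
  have h13 : N.dim 1 3 = N.dim 0 3 := by omega
  have h23 : N.dim 2 3 = N.dim 0 3 := by omega
  by_cases h01 : N.dim 0 1 = 1
  · exact .inr (.inl (hA.hasForm1 hN h01 h h13 h23))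
  rcases hA.hasCoordinates hN h13 h23 (.inl ⟨h, by omega⟩) with hc | hc
  · have hd := hc.dim_eq
    rw [Complex.finrank_real_complex] at hd
    -- Over $\mathbb C$, $1<d_{01}\le d_{02}=2$ leaves no room for a proper subspace.
    exact .inr (.inr (.inl (hc.hasForm3 (by omega) h)))
  · exact .inr (.inr (.inr (hc.hasForm4 h)))

theorem IsFull.hasAssociativeForm_of_dim_eq (hN : N.IsFull) (hA : N.IsAssociative)
    (hC : N.IsClifford) (h23 : N.dim 2 3 = N.dim 0 3) : N.HasAssociativeForm := by
  obtain ⟨h1, h2, h3, h4⟩ := hN.isClifford_iff_rank_four.1 hC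
  by_cases h : N.dim 1 2 = N.dim 0 2
  · exact (hN.hasNilForm_of_dim_eq hA hC h).hasAssociativeForm
  have hle1 := hN.dim_le_right (i := 0) (j := 1) (k := 2) (by decide) (by decide)
  have hle2 := hN.dim_le_right (i := 0) (j := 1) (k := 3) (by decide) (by decide)
  have hle3 := hN.dim_le_right (i := 1) (j := 2) (k := 3) (by decide) (by decide)
  have hpos := hN.dim_pos (i := 1) (j := 2) (by decide)
  have h01 : N.dim 0 1 = N.dim 0 2 := by omega
  have h13 : N.dim 1 3 = N.dim 0 3 := by omega
  by_cases h12 : N.dim 1 2 = 1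
  · exact .inr (.inr (.inl (hA.hasForm2 hN h12 h01 h13 h23)))
  rcases hA.hasCoordinates hN h13 h23 (.inr ⟨h01, by omega⟩) with hc | hc
  · have hd := hc.dim_eq
    rw [Complex.finrank_real_complex] at hd
    -- This case is empty: $1<d_{12}<d_{02}=2$ is impossible.
    exact .inr (.inr (.inr (.inl (hc.hasForm3 h01 (by omega)))))
  · exact .inr (.inr (.inr (.inr (.inr (hc.hasForm5 h01)))))

/-- Anti-transposition exchanges $d_{23}=d_{03}$ with $d_{01}=d_{03}$. If neither holds, the
Clifford condition forces $d_{02}=d_{13}=d_{12}=d_{03}$, the bigraded case. -/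
theorem IsFull.hasAssociativeForm_or_dual (hN : N.IsFull) (hA : N.IsAssociative)
    (hC : N.IsClifford) : N.HasAssociativeForm ∨ N.dual.HasAssociativeForm := by
  obtain ⟨h1, h2, h3, h4⟩ := hN.isClifford_iff_rank_four.1 hC
  by_cases h23 : N.dim 2 3 = N.dim 0 3
  · exact .inl (hN.hasAssociativeForm_of_dim_eq hA hC h23)
  by_cases h01 : N.dim 0 1 = N.dim 0 3
  · exact .inr (hN.dual.hasAssociativeForm_of_dim_eq hA.dual (hN.isClifford_dual hC) h01)
  · exact .inl (hN.hasNilForm_of_dim_eq hA hC (by omega)).hasAssociativeForm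

end Classification

/-! ### Arbitrary universes and the final equivalences -/

section Transfer

variable {N : QuasiNil.{u} 4} {N' : QuasiNil.{v} 4}

theorem Isomorphic.hasAssociativeForm (h : N.Isomorphic N') (h' : N'.HasAssociativeForm) :
    N.HasAssociativeForm := by
  rcases h' with ⟨_, _, _, _, _, _, M, h'⟩ | ⟨_, _, _, M, h'⟩ | ⟨_, _, _, M, h'⟩ | ⟨n, h'⟩ |
    ⟨W, n, h'⟩ | ⟨W, n, h'⟩
  · exact .inl ⟨_, _, _, _, _, _, M, h.trans h'⟩
  · exact .inr (.inl ⟨_, _, _, M, h.trans h'⟩)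
  · exact .inr (.inr (.inl ⟨_, _, _, M, h.trans h'⟩))
  · exact .inr (.inr (.inr (.inl ⟨n, h.trans h'⟩)))
  · exact .inr (.inr (.inr (.inr (.inl ⟨W, n, h.trans h'⟩))))
  · exact .inr (.inr (.inr (.inr (.inr ⟨W, n, h.trans h'⟩))))

theorem Isomorphic.hasNilForm (h : N.Isomorphic N') (h' : N'.HasNilForm) : N.HasNilForm := by
  rcases h' with ⟨_, _, _, _, _, _, M, h'⟩ | ⟨_, _, _, M, h'⟩ | ⟨n, h'⟩ | ⟨W, n, h'⟩
  · exact .inl ⟨_, _, _, _, _, _, M, h.trans h'⟩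
  · exact .inr (.inl ⟨_, _, _, M, h.trans h'⟩)
  · exact .inr (.inr (.inl ⟨n, h.trans h'⟩))
  · exact .inr (.inr (.inr ⟨W, n, h.trans h'⟩))

theorem IsFull.of_dual (hN : N.IsFull) (hA : N.dual.IsAssociative) (hC : N.dual.IsClifford) :
    N.IsAssociative ∧ N.IsClifford := by
  refine ⟨isAssociative_iff_rank_four.2 fun x y z =>
    (isAssociative_iff_rank_four.1 hA z y x).symm, ?_⟩
  obtain ⟨h1, h2, h3, h4⟩ := hN.dual.isClifford_iff_rank_four.1 hC
  exact hN.isClifford_iff_rank_four.2 ⟨h4.symm, h3.symm, h2.symm, h1.symm⟩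

/-- The classification of associative Clifford algebras. -/
theorem IsFull.isAssociative_and_isClifford_iff (hN : N.IsFull) :
    N.IsAssociative ∧ N.IsClifford ↔ N.HasAssociativeForm ∨ N.dual.HasAssociativeForm := by
  constructor
  · rintro ⟨hA, hC⟩
    -- The models are built from spaces in the lowest universe, so the case analysis is carried out
    -- on a copy of `N` there.
    obtain ⟨N', h⟩ := N.exists_isomorphic_univ_zero
    exact ((hN.of_isomorphic h).hasAssociativeForm_or_dual (h.isAssociative hA)
      (hN.isClifford_of_isomorphic h hC)).imp h.hasAssociativeForm h.dual.hasAssociativeForm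
  · rintro (h | h)
    · exact hN.of_hasAssociativeForm h
    · obtain ⟨hA, hC⟩ := hN.dual.of_hasAssociativeForm h
      exact hN.of_dual hA hC

/-- The four Nil forms are singled out among associative Clifford algebras by one equality of
dimensions, which can be compared directly with the Vinberg condition. -/
theorem IsFull.hasNilForm_iff (hN : N.IsFull) :
    N.HasNilForm ↔ (N.IsAssociative ∧ N.IsClifford) ∧ N.dim 1 2 = N.dim 0 2 := by
  constructor
  · exact fun h => ⟨hN.of_hasAssociativeForm h.hasAssociativeForm, hN.dim_eq_of_hasNilForm h⟩
  · rintro ⟨⟨hA, hC⟩, hd⟩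
    obtain ⟨N', h⟩ := N.exists_isomorphic_univ_zero
    rw [h.dim_eq, h.dim_eq] at hd
    exact h.hasNilForm ((hN.of_isomorphic h).hasNilForm_of_dim_eq (h.isAssociative hA)
      (hN.isClifford_of_isomorphic h hC) hd)

end Transfer

end QuasiNil

end
theorem mainTheorem1 (N : QuasiNil.{u} 4) (hindex : N.nilpotencyIndex = 3) :
    -- (a) the associative Clifford quasiNil-algebras
    ((N.IsAssociative ∧ N.IsClifford) ↔ (N.HasAssociativeForm ∨ N.dual.HasAssociativeForm)) ∧
    -- (b) those among them that are not Clifford Nil-algebras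
    (N.IsAssociative → N.IsClifford →
      (¬ (N.IsNil ∧ N.IsClifford) ↔ (N.IsExceptional ∨ N.dual.IsExceptional))) ∧
    -- the Clifford Nil-algebras
    ((N.IsNil ∧ N.IsClifford) ↔ (N.HasNilForm ∨ N.dual.HasNilForm)) := by
  have hN := QuasiNil.isFull_of_nilpotencyIndex hindex
  refine ⟨hN.isAssociative_and_isClifford_iff, fun hA hC => ?_, ?_⟩
  · rw [hN.isNil_and_isClifford_iff]
    constructor
    · intro h
      have hne : N.dim 1 2 ≠ N.dim 0 2 ∧ N.dim 1 2 ≠ N.dim 1 3 :=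
        ⟨fun h' => h ⟨⟨hA, hC⟩, .inl h'⟩, fun h' => h ⟨⟨hA, hC⟩, .inr h'⟩⟩
      exact (hN.isAssociative_and_isClifford_iff.1 ⟨hA, hC⟩).imp
        (fun h => hN.isExceptional_of_hasAssociativeForm h hne.1)
        -- Anti-transposition fixes position $(1,2)$ and exchanges $(0,2)$ with $(1,3)$, so the
        -- second inequality for `N` is the first one for its dual.
        (fun h => hN.dual.isExceptional_of_hasAssociativeForm h hne.2)
    · rintro (h | h) ⟨-, hd⟩
      · exact hd.elim (hN.dim_ne_of_isExceptional h).1 (hN.dim_ne_of_isExceptional h).2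
      · exact hd.elim (hN.dual.dim_ne_of_isExceptional h).2 (hN.dual.dim_ne_of_isExceptional h).1
  · rw [hN.isNil_and_isClifford_iff, hN.hasNilForm_iff, hN.dual.hasNilForm_iff]
    constructor
    · rintro ⟨⟨hA, hC⟩, hd⟩
      exact hd.imp (fun hd => ⟨⟨hA, hC⟩, hd⟩) (fun hd => ⟨⟨hA.dual, hN.isClifford_dual hC⟩, hd⟩)
    · rintro (⟨h, hd⟩ | ⟨⟨hA, hC⟩, hd⟩)
      · exact ⟨h, .inl hd⟩
      · exact ⟨hN.of_dual hA hC, .inr hd⟩
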